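/- Let $k$ be an infinite field, $R=k[x_1,\dots,x_d]$, $\mathfrak m=(x_1,\dots,x_d)$, and let $I\subseteq R$ be a nonzero ideal generated by monomials $f_1,\dots,f_u$ of the same degree $\delta$. Let $\ell$ be the analytic spread of $I$, that is, the Krull dimension of the special fiber ring $\bigoplus_{n\ge 0} I^n/\mathfrak m I^n$. Let $z=(z_{ij})$ be an $\ell\times u$ matrix of variables and let $J\subseteq k[z][x_1,\dots,x_d]$ be the ideal generated by $b_i=\sum_{j=1}^u z_{ij}f_j$, $1\le i\le \ell$. For $\lambda\in k^{\ell\times u}$ let $\pi_\lambda: k[z][x_1,\dots,x_d]\to R$ be the evaluation $z_{ij}\mapsto\lambda_{ij}$ and let $J_\lambda=\pi_\lambda(J)$. For an ideal $L$ of $A[x_1,\dots,x_d]$, with $A$ a Noetherian ring, let $\operatorname{mono}(L)$ be the ideal generated by all elements of $L$ of the form $a\,m$ with $a\in A$ and $m$ a monomial in $x_1,\dots,x_d$. A reduction of $I$ is an ideal $K\subseteq I$ with $I^{n+1}=KI^n$ for some $n\ge 0$, and $\operatorname{gradedcore}(I)$ is the intersection of all homogeneous reductions of $I$ (for the standard grading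 of $R$). Write $\operatorname{mono}(J)=\sum_{i=1}^r C_i\,\mathbf x^{\mathbf v_i}$ with distinct $\mathbf v_1,\dots,\mathbf v_r\in\mathbb N^d$ and ideals $C_i\subseteq k[z]$, and let $\mathcal C=C_1+\dots+C_r$ be the content ideal. If $\sqrt{C_i}=\sqrt{\mathcal C}$ for every $i$ (in particular, if $\sqrt{C_i}=\mathcal C$ for every $i$), then $$\operatorname{gradedcore}(I)=\operatorname{mono}(J_\lambda)\quad\text{for general }\lambda,$$ that is, for all $\lambda$ in a dense Zariski open subset of $k^{\ell\times u}$. -/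

import Mathlib

open MvPolynomial

noncomputable section

/-- `mono(L)` for an ideal `L` of a polynomial ring `A[x]`: the ideal generated by the elements of
`L` of the form `a * m`, where `a ∈ A` and `m` is a monomial in the variables `x`. -/
def mono {σ A : Type*} [CommRing A] (L : Ideal (MvPolynomial σ A)) :
    Ideal (MvPolynomial σ A) :=
  Ideal.span {p | p ∈ L ∧ ∃ (m : σ →₀ ℕ) (a : A), p = monomial m a}

/-- `K` is a reduction of `I`: `K ⊆ I` and `I ^ (n + 1) = K * I ^ n` for some `n`
(equivalently for all large `n`). -/
def IsReductionOf {R : Type*} [CommRing R] (K I : Ideal R) : Prop :=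
  K ≤ I ∧ ∃ n : ℕ, I ^ (n + 1) = K * I ^ n

/-- The graded core of an ideal of a standard graded polynomial ring: the intersection of all its
homogeneous reductions. -/
def gradedCore {σ k : Type*} [CommRing k] (I : Ideal (MvPolynomial σ k)) :
    Ideal (MvPolynomial σ k) :=
  letI : GradedAlgebra (homogeneousSubmodule σ k) := MvPolynomial.gradedAlgebra
  sInf {K | K.IsHomogeneous (homogeneousSubmodule σ k) ∧ IsReductionOf K I}

/-- The special fiber ring `⨁ n, I ^ n / 𝔪 I ^ n`, where `𝔪` is generated by the variables,
as the quotient of the Rees algebra `⨁ n, I ^ n` by its ideal generated by `𝔪`. -/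
abbrev SpecialFiberRing {σ k : Type*} [CommRing k] (I : Ideal (MvPolynomial σ k)) : Type _ :=
  reesAlgebra I ⧸ (Ideal.span (Set.range (X : σ → MvPolynomial σ k))).map
    (algebraMap (MvPolynomial σ k) (reesAlgebra I))

/-- The analytic spread of `I`: the Krull dimension of the special fiber ring. -/
def analyticSpread {σ k : Type*} [CommRing k] (I : Ideal (MvPolynomial σ k)) : WithBot ℕ∞ :=
  ringKrullDim (SpecialFiberRing I)

/-- The ideal of `k[z][x]` generated by the `s` generic linear combinations
`b i = ∑ j, z i j * f j` of `f 1, …, f u ∈ k[x]`, with `z` an `s × u` matrix of variables. -/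
def genericIdeal {σ k : Type*} [CommRing k] (s : ℕ) {u : ℕ} (f : Fin u → MvPolynomial σ k) :
    Ideal (MvPolynomial σ (MvPolynomial (Fin s × Fin u) k)) :=
  Ideal.span (Set.range fun i : Fin s =>
    ∑ j : Fin u, C (X (i, j)) * MvPolynomial.map (C : k →+* MvPolynomial (Fin s × Fin u) k) (f j))

/-- The evaluation map `k[z][x] → k[x]`, `z i ↦ lam i`. -/
def evalParam {σ τ k : Type*} [CommRing k] (lam : τ → k) :
    MvPolynomial σ (MvPolynomial τ k) →+* MvPolynomial σ k :=
  MvPolynomial.map (MvPolynomial.eval lam)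

/-- `P lam` holds for general `lam` in the affine space `k ^ τ`: it holds on a nonempty basic
Zariski open set. Over an infinite field and for finite `τ` this says that `P` holds on a
dense Zariski open subset. -/
def ForGeneral {τ k : Type*} [CommRing k] (P : (τ → k) → Prop) : Prop :=
  ∃ q : MvPolynomial τ k, q ≠ 0 ∧ ∀ lam : τ → k, MvPolynomial.eval lam q ≠ 0 → P lam

end

/-!
Write `V` for the `k`-span of the monomials `f j`, all of degree `δ`, and `J_λ` for the
specialization of the generic ideal `J` at `λ`. The proof compares three kinds of ideals.

*Homogeneous reductions.* By the graded Nakayama lemma a homogeneous reduction `K` of `I` is already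
a reduction through its part `K ∩ V` of degree `δ`; so the special fiber ring is integral over the
subalgebra generated by the linear forms that come from `K ∩ V`. A Noether normalization by linear
combinations of these forms has at most `dim = ℓ` elements, and lifting it to `V` gives a `λ` such
that `J_λ ⊆ K` is again a reduction (`exists_reduction_of_analyticSpread`).

*Points where `J_λ` is a reduction.* If `J_λ` is a reduction, then Nakayama's lemma at the point `λ`
of the parameter space gives a polynomial `r` with `r(λ) = 1` and `r I ^ (n + 1) ⊆ J I ^ n`
(`exists_eval_eq_one_forall_mem`). Hence being a reduction is an open condition. Moreover
`r f_j ^ (n + 1)` lies in `mono J`, so `r` lies in the content ideal, and since all `C_i` have the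
same radical as the content ideal, no `C_i` vanishes at `λ`: every `x ^ v_i` lies in `J_λ`. As every
homogeneous reduction contains such a `J_λ`, all `x ^ v_i` lie in the graded core.

*General `λ`.* For general `λ` a monomial of `J_λ` has a nonzero multiple `a x ^ m` in `J`
(`exists_forall_monomial_mem_of_map`), so it is divisible by some `x ^ v_i`. This gives
`mono J_λ ⊆ gradedcore I`. Conversely the graded core is contained in the reduction `J_λ`, and it is
a monomial ideal because the torus permutes the homogeneous reductions
(`monomial_coeff_mem_gradedCore`).

That the monomials of `J_λ` are controlled by finitely many conditions on `λ` is seen by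
elimination: `mono J` consists of the elements free of `y` in the ideal obtained from `J` by
rescaling each `x i` by a new unit `y i`, and the leading exponents of an ideal for a monomial order
do not grow under a general specialization (`exists_forall_degree_map_eq`).
-/

/-! ### Krull dimension and linear Noether normalization -/

theorem ringKrullDim_le_of_isIntegral_of_injective {R S : Type*} [CommRing R] [CommRing S]
    [Algebra R S] [Algebra.IsIntegral R S] (hinj : Function.Injective (algebraMap R S)) :
    ringKrullDim R ≤ ringKrullDim S := by
  refine iSup_le fun l => ?_
  obtain ⟨Q, -, hQ, hQl⟩ := Ideal.exists_ideal_over_prime_of_isIntegral l.head.asIdeal (⊥ : Ideal S)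
    (by rw [← RingHom.ker_eq_comap_bot, (RingHom.injective_iff_ker_eq_bot _).1 hinj]; exact bot_le)
  have : Q.LiesOver l.head.asIdeal := ⟨hQl.symm⟩
  obtain ⟨L, hL, -⟩ := Ideal.exists_ltSeries_of_hasGoingUp (S := S) l Q
  exact hL ▸ Order.LTSeries.length_le_krullDim L

/-- Substituting linear polynomials `b i + a i * T` of one variable into `p`: the coefficient of
`T ^ n`, for `n` at least the degree of `p`, is the homogeneous component of degree `n` at `a`. -/
theorem coeff_aeval_linear {k B : Type*} [CommRing k] [CommRing B] [Algebra k B] {m : ℕ}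
    (a : Fin m → k) (b : Fin m → B) (p : MvPolynomial (Fin m) k) {n : ℕ} (hn : p.totalDegree ≤ n) :
    (aeval (fun i => Polynomial.C (b i) + Polynomial.C (algebraMap k B (a i)) * Polynomial.X) p
      : Polynomial B).natDegree ≤ n ∧
    (aeval (fun i => Polynomial.C (b i) + Polynomial.C (algebraMap k B (a i)) * Polynomial.X) p
      : Polynomial B).coeff n = algebraMap k B (eval a (homogeneousComponent n p)) := by
  set L : Fin m → Polynomial B :=
    fun i => Polynomial.C (b i) + Polynomial.C (algebraMap k B (a i)) * Polynomial.X with hL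
  have hLd : ∀ i, (L i).natDegree ≤ 1 := fun i => by
    simp only [hL]; compute_degree
  have hmon : ∀ e : Fin m →₀ ℕ, (∏ i, L i ^ e i).natDegree ≤ e.degree ∧
      (∏ i, L i ^ e i).coeff e.degree = algebraMap k B (∏ i, a i ^ e i) := by
    intro e
    have key : ∀ s : Finset (Fin m), (∏ i ∈ s, L i ^ e i).natDegree ≤ ∑ i ∈ s, e i ∧
        (∏ i ∈ s, L i ^ e i).coeff (∑ i ∈ s, e i) = algebraMap k B (∏ i ∈ s, a i ^ e i) := by
      intro s
      induction s using Finset.induction_on with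
      | empty => simp
      | insert j s hj ih =>
        have h1 : (L j ^ e j).natDegree ≤ e j := by
          simpa using Polynomial.natDegree_pow_le_of_le (e j) (hLd j)
        have h2 : (L j ^ e j).coeff (e j) = algebraMap k B (a j) ^ e j := by
          have := Polynomial.coeff_pow_of_natDegree_le (m := e j) (hLd j)
          simpa [hL] using this
        rw [Finset.prod_insert hj, Finset.sum_insert hj, Finset.prod_insert hj]
        refine ⟨Polynomial.natDegree_mul_le_of_le h1 ih.1, ?_⟩
        rw [Polynomial.coeff_mul_add_eq_of_natDegree_le h1 ih.1, h2, ih.2]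
        simp
    rw [Finsupp.degree_eq_sum]
    exact key Finset.univ
  have hp : aeval L p = ∑ e ∈ p.support,
      Polynomial.C (algebraMap k B (p.coeff e)) * ∏ i, L i ^ e i := by
    rw [aeval_def, eval₂_eq']
    rfl
  have hdeg : ∀ e ∈ p.support, e.degree ≤ n := fun e he =>
    (by rw [Finsupp.degree_eq_sum, ← Finsupp.sum_fintype _ (fun _ x => x) (by simp)];
        exact le_totalDegree he : e.degree ≤ p.totalDegree).trans hn
  rw [hp]
  constructor
  · refine Polynomial.natDegree_sum_le_of_forall_le _ _ fun e he => ?_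
    exact (Polynomial.natDegree_C_mul_le _ _).trans ((hmon e).1.trans (hdeg e he))
  · rw [Polynomial.finsetSum_coeff, homogeneousComponent_apply, map_sum, map_sum,
      Finset.sum_filter]
    refine Finset.sum_congr rfl fun e he => ?_
    rw [Polynomial.coeff_C_mul]
    split_ifs with h
    · rw [← h, (hmon e).2, eval_monomial, map_mul, Finsupp.prod_fintype _ _ (by simp)]
    · rw [Polynomial.coeff_eq_zero_of_natDegree_lt, mul_zero]
      exact (hmon e).1.trans_lt (lt_of_le_of_ne (hdeg e he) h)

theorem isIntegral_adjoin_of_forall_mem {k F : Type*} [CommRing k] [CommRing F] [Algebra k F]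
    {s : Set F} {A : Subalgebra k F} (hs : ∀ x ∈ s, IsIntegral A x) {b : F}
    (hb : IsIntegral (Algebra.adjoin k s) b) : IsIntegral A b := by
  have hle : Algebra.adjoin k s ≤ (integralClosure A F).restrictScalars k :=
    Algebra.adjoin_le hs
  obtain ⟨p, hp, hpb⟩ := hb
  let g : Algebra.adjoin k s →+* integralClosure A F :=
    (algebraMap (Algebra.adjoin k s) F).codRestrict (integralClosure A F) fun x => hle x.2
  refine isIntegral_trans (R := A) (A := integralClosure A F) b
    ⟨p.map g, hp.map _, ?_⟩
  rw [Polynomial.eval₂_map]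
  exact hpb

/-- Linear Noether normalization: if `F` is integral over the subalgebra generated by finitely many
elements, then it is integral over the subalgebra generated by algebraically independent linear
combinations of these elements. -/
theorem exists_linear_noether_normalization {k F : Type*} [Field k] [Infinite k] [CommRing F]
    [Nontrivial F] [Algebra k F] (m : ℕ) (y : Fin m → F)
    (hint : ∀ b : F, IsIntegral (Algebra.adjoin k (Set.range y)) b) :
    ∃ (m' : ℕ) (y' : Fin m' → F), (∀ i, y' i ∈ Submodule.span k (Set.range y)) ∧
      AlgebraicIndependent k y' ∧ ∀ b : F, IsIntegral (Algebra.adjoin k (Set.range y')) b := by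
  induction m with
  | zero =>
    exact ⟨0, y, fun i => i.elim0, algebraicIndependent_empty_type, hint⟩
  | succ m ih =>
    by_cases hy : AlgebraicIndependent k y
    · exact ⟨_, y, fun i => Submodule.subset_span ⟨i, rfl⟩, hy, hint⟩
    obtain ⟨p, hp, hp0⟩ : ∃ p : MvPolynomial (Fin (m + 1)) k, aeval y p = 0 ∧ p ≠ 0 := by
      rw [algebraicIndependent_iff] at hy
      push Not at hy
      exact hy
    -- a direction in which the leading form of the relation does not vanish
    obtain ⟨a, ha⟩ : ∃ a : Fin (m + 1) → k,
        eval a (homogeneousComponent p.totalDegree p * X 0) ≠ 0 := by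
      by_contra! h
      have h0 : homogeneousComponent p.totalDegree p * X 0 = 0 :=
        MvPolynomial.funext (by simpa using h)
      have hX : (X 0 : MvPolynomial (Fin (m + 1)) k) ≠ 0 := X_ne_zero 0
      obtain ⟨e, he, hed⟩ := Finset.exists_mem_eq_sup p.support (support_nonempty.2 hp0)
        fun e => e.sum fun _ n => n
      have hc := congrArg (coeff e) ((mul_eq_zero.1 h0).resolve_right hX)
      rw [coeff_homogeneousComponent, if_pos, coeff_zero] at hc
      · exact mem_support_iff.1 he hc
      · rw [Finsupp.degree_eq_sum, ← Finsupp.sum_fintype _ (fun _ x => x) (by simp)]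
        exact hed.symm
    rw [eval_mul, eval_X] at ha
    have ha0 : a 0 ≠ 0 := right_ne_zero_of_mul ha
    set s : F := (a 0)⁻¹ • y 0 with hs
    set y' : Fin m → F := fun i => y i.succ - a i.succ • s with hy'
    set A := Algebra.adjoin k (Set.range y') with hA
    have hy'A : ∀ i, y' i ∈ A := fun i => Algebra.subset_adjoin ⟨i, rfl⟩
    have hsint : IsIntegral A s := by
      let b : Fin (m + 1) → A := Fin.cons 0 fun i => ⟨y' i, hy'A i⟩
      obtain ⟨hd, hc⟩ := coeff_aeval_linear a b p le_rfl
      set q : Polynomial A := aeval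
        (fun i => Polynomial.C (b i) + Polynomial.C (algebraMap k A (a i)) * Polynomial.X) p with hq
      set c : k := eval a (homogeneousComponent p.totalDegree p)
      have hc0 : c ≠ 0 := left_ne_zero_of_mul ha
      refine ⟨Polynomial.C (algebraMap k A c⁻¹) * q, ?_, ?_⟩
      · refine Polynomial.monic_of_natDegree_le_of_coeff_eq_one p.totalDegree
          ((Polynomial.natDegree_C_mul_le _ _).trans hd) ?_
        rw [Polynomial.coeff_C_mul, hc, ← map_mul, inv_mul_cancel₀ hc0, map_one]
      · have : Polynomial.eval₂ (algebraMap A F) s q = aeval y p := by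
          rw [hq, ← Polynomial.aeval_def]
          have h2 : ((Polynomial.aeval s : Polynomial A →ₐ[A] F).restrictScalars k).comp (aeval
              (fun i => Polynomial.C (b i) + Polynomial.C (algebraMap k A (a i)) * Polynomial.X)) =
              aeval y := by
            refine MvPolynomial.algHom_ext fun i => ?_
            have h3 : algebraMap A F (algebraMap k A (a i)) = algebraMap k F (a i) := rfl
            simp only [AlgHom.comp_apply, aeval_X, AlgHom.restrictScalars_apply, map_add, map_mul,
              Polynomial.aeval_C, Polynomial.aeval_X, h3]
            rw [← Algebra.smul_def]
            refine Fin.cases ?_ (fun i => ?_) i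
            · simp [b, hs, ha0]
            · change y' i + _ = _
              simp [hy']
          exact DFunLike.congr_fun h2 p
        rw [Polynomial.eval₂_mul, this, hp, mul_zero]
    have hkA : ∀ c : k, IsIntegral A (algebraMap k F c) := fun c =>
      isIntegral_algebraMap (x := algebraMap k A c)
    have hsmul : ∀ c : k, IsIntegral A (c • s) := fun c => by
      rw [Algebra.smul_def]; exact (hkA c).mul hsint
    have hyint : ∀ x ∈ Set.range y, IsIntegral A x := by
      rintro _ ⟨i, rfl⟩
      refine Fin.cases ?_ (fun i => ?_) i
      · have : y 0 = a 0 • s := by simp [hs, ha0]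
        rw [this]; exact hsmul _
      · have : y i.succ = algebraMap A F ⟨y' i, hy'A i⟩ + a i.succ • s := by
          change _ = y' i + _
          simp [hy']
        rw [this]; exact isIntegral_algebraMap.add (hsmul _)
    obtain ⟨m', w, hw, hwi, hwint⟩ := ih y' fun b => isIntegral_adjoin_of_forall_mem hyint (hint b)
    refine ⟨m', w, fun i => ?_, hwi, hwint⟩
    refine (Submodule.span_le.2 ?_ : Submodule.span k (Set.range y') ≤ _) (hw i)
    rintro _ ⟨i, rfl⟩
    exact sub_mem (Submodule.subset_span ⟨_, rfl⟩) (Submodule.smul_mem _ _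
      (Submodule.smul_mem _ _ (Submodule.subset_span ⟨_, rfl⟩)))

/-- The number of algebraically independent elements in a linear Noether normalization is at most
the Krull dimension, so with zeros added there are exactly as many as the Krull dimension. -/
theorem exists_isIntegral_adjoin_of_ringKrullDim {k F : Type*} [Field k] [Infinite k] [CommRing F]
    [Algebra k F] {ℓ m : ℕ} (hℓ : ringKrullDim F = ℓ) (y : Fin m → F)
    (hint : ∀ b : F, IsIntegral (Algebra.adjoin k (Set.range y)) b) :
    ∃ w : Fin ℓ → F, (∀ i, w i ∈ Submodule.span k (Set.range y)) ∧
      ∀ b : F, IsIntegral (Algebra.adjoin k (Set.range w)) b := by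
  have : Nontrivial F := by
    by_contra h
    rw [not_nontrivial_iff_subsingleton] at h
    rw [ringKrullDim_eq_bot_of_subsingleton] at hℓ
    exact absurd hℓ (by simp)
  obtain ⟨n, y', hspan, hind, hint'⟩ := exists_linear_noether_normalization m y hint
  have hn : n ≤ ℓ := by
    have : Algebra.IsIntegral (Algebra.adjoin k (Set.range y')) F := ⟨hint'⟩
    have h := ringKrullDim_le_of_isIntegral_of_injective
      (R := Algebra.adjoin k (Set.range y')) (S := F) Subtype.val_injective
    rw [← ringKrullDim_eq_of_ringEquiv hind.aevalEquiv.toRingEquiv,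
      MvPolynomial.ringKrullDim_of_isNoetherianRing, hℓ] at h
    simpa using h
  refine ⟨fun i => if h : i.1 < n then y' ⟨i, h⟩ else 0, fun i => ?_, fun b => ?_⟩
  · dsimp only
    split_ifs with h
    · exact hspan _
    · exact zero_mem _
  · refine isIntegral_adjoin_of_forall_mem ?_ (hint' b)
    rintro _ ⟨i, rfl⟩
    exact isIntegral_algebraMap (x := (⟨y' i, Algebra.subset_adjoin
      ⟨⟨i, i.2.trans_le hn⟩, by simp⟩⟩ : Algebra.adjoin k (Set.range _)))

/-! ### Ideals generated by forms of one degree -/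

section GradedNakayama

variable {σ k : Type*} [Field k]

theorem homogeneousComponent_mul_of_isHomogeneous {D : ℕ} (r : MvPolynomial σ k)
    {s : MvPolynomial σ k} (hs : s.IsHomogeneous D) :
    homogeneousComponent D (r * s) = C (coeff 0 r) * s := by
  classical
  ext e
  rw [coeff_homogeneousComponent, coeff_C_mul]
  split_ifs with h
  · rw [coeff_mul, Finset.sum_eq_single (0, e)]
    · rintro ⟨a, b⟩ hab hne
      rw [Finset.HasAntidiagonal.mem_antidiagonal] at hab
      rw [hs.coeff_eq_zero, mul_zero]
      rintro hb
      dsimp only at hb hab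
      have ha : a.degree = 0 := by
        have := congrArg Finsupp.degree hab
        rw [map_add] at this; omega
      rw [Finsupp.degree_eq_zero_iff] at ha
      subst ha
      simp_all
    · simp
  · rw [hs.coeff_eq_zero h, mul_zero]

theorem coeff_zero_of_mem_idealOfVars {p : MvPolynomial σ k} (hp : p ∈ idealOfVars σ k) :
    coeff 0 p = 0 := by
  rw [← pow_one (idealOfVars σ k), mem_pow_idealOfVars_iff'] at hp
  exact hp 0 (by simp)

theorem sub_C_coeff_zero_mem_idealOfVars (p : MvPolynomial σ k) :
    p - C (coeff 0 p) ∈ idealOfVars σ k := by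
  rw [← pow_one (idealOfVars σ k), mem_pow_idealOfVars_iff']
  intro e he
  rw [Nat.lt_one_iff, Finsupp.degree_eq_zero_iff] at he
  simp [he]

theorem homogeneousComponent_eq_zero_of_mem {D : ℕ} {V : Submodule k (MvPolynomial σ k)}
    (hV : V ≤ homogeneousSubmodule σ k D) {p : MvPolynomial σ k}
    (hp : p ∈ idealOfVars σ k * Ideal.span (V : Set (MvPolynomial σ k))) :
    homogeneousComponent D p = 0 := by
  induction hp using Submodule.mul_induction_on' with
  | mem_mul_mem r hr s hs =>
    induction hs using Submodule.span_induction generalizing r with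
    | mem s hs =>
      rw [homogeneousComponent_mul_of_isHomogeneous _ (hV hs),
        coeff_zero_of_mem_idealOfVars hr, C_0, zero_mul]
    | zero => simp
    | add s t _ _ hs ht => rw [mul_add, map_add, hs r hr, ht r hr, add_zero]
    | smul b s _ hs =>
      rw [smul_eq_mul, ← mul_assoc r]
      exact hs _ (Ideal.mul_mem_right _ _ hr)
  | add y _ z _ hy hz => rw [map_add, hy, hz, add_zero]

/-- An element of the ideal generated by forms of degree `D` is, modulo `𝔪` times that ideal, equal
to its component of degree `D`, which is a `k`-linear combination of the given forms. -/
theorem homogeneousComponent_mem_of_mem_span {D : ℕ} {V : Submodule k (MvPolynomial σ k)}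
    (hV : V ≤ homogeneousSubmodule σ k D) {p : MvPolynomial σ k}
    (hp : p ∈ Ideal.span (V : Set (MvPolynomial σ k))) :
    homogeneousComponent D p ∈ V ∧ p - homogeneousComponent D p ∈
      idealOfVars σ k * Ideal.span (V : Set (MvPolynomial σ k)) := by
  induction hp using Submodule.span_induction with
  | mem x hx =>
    rw [homogeneousComponent_eq_self (hV hx), sub_self]
    exact ⟨hx, zero_mem _⟩
  | zero => simp
  | add x y _ _ hx hy =>
    rw [map_add, add_sub_add_comm]
    exact ⟨add_mem hx.1 hy.1, add_mem hx.2 hy.2⟩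
  | smul a x hxs hx =>
    obtain ⟨h1, h2⟩ := hx
    have h3 : homogeneousComponent D (a * x) = C (coeff 0 a) * homogeneousComponent D x := by
      have h4 : a * x = a * homogeneousComponent D x + a * (x - homogeneousComponent D x) := by ring
      rw [h4, map_add, homogeneousComponent_eq_zero_of_mem hV (Ideal.mul_mem_left _ _ h2), add_zero,
        homogeneousComponent_mul_of_isHomogeneous _ (homogeneousComponent_isHomogeneous D x)]
    rw [smul_eq_mul, h3]
    refine ⟨by rw [C_mul']; exact V.smul_mem _ h1, ?_⟩
    have h5 : a * x - C (coeff 0 a) * homogeneousComponent D x =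
        a * (x - homogeneousComponent D x) + (a - C (coeff 0 a)) * homogeneousComponent D x := by
      ring
    rw [h5]
    exact add_mem (Ideal.mul_mem_left _ _ h2) (Ideal.mul_mem_mul
      (sub_C_coeff_zero_mem_idealOfVars a) (Ideal.subset_span h1))

theorem span_coe_mul {k R : Type*} [CommRing k] [CommRing R] [Algebra k R] (V W : Submodule k R) :
    Ideal.span ((V * W : Submodule k R) : Set R) =
      Ideal.span (V : Set R) * Ideal.span (W : Set R) := by
  apply le_antisymm
  · refine Ideal.span_le.2 fun x hx => ?_
    refine Submodule.mul_induction_on hx (fun v hv w hw => ?_) fun _ _ => add_mem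
    exact Ideal.mul_mem_mul (Ideal.subset_span hv) (Ideal.subset_span hw)
  · rw [Ideal.span_mul_span']
    refine Ideal.span_mono ?_
    rintro _ ⟨v, hv, w, hw, rfl⟩
    exact Submodule.mul_mem_mul hv hw

theorem span_coe_pow {k R : Type*} [CommRing k] [CommRing R] [Algebra k R] (V : Submodule k R)
    (n : ℕ) : Ideal.span ((V ^ n : Submodule k R) : Set R) = Ideal.span (V : Set R) ^ n := by
  induction n with
  | zero =>
    rw [pow_zero, pow_zero, Ideal.one_eq_top, Ideal.eq_top_iff_one]
    exact Ideal.subset_span (Submodule.one_le.1 le_rfl)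
  | succ n ih => rw [pow_succ, pow_succ, span_coe_mul, ih]

theorem pow_le_homogeneousSubmodule {δ : ℕ} {V : Submodule k (MvPolynomial σ k)}
    (hV : V ≤ homogeneousSubmodule σ k δ) (n : ℕ) : V ^ n ≤ homogeneousSubmodule σ k (n * δ) := by
  induction n with
  | zero =>
    rw [pow_zero, Submodule.one_le, zero_mul]
    exact isHomogeneous_one σ k
  | succ n ih =>
    rw [pow_succ, Nat.succ_mul]
    exact (mul_le_mul' ih hV).trans (homogeneousSubmodule_mul _ _)

/-- Graded Nakayama lemma for powers of an ideal generated by the forms `V` of degree `δ`. -/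
theorem pow_succ_le_mul_pow_of_subset {δ : ℕ} {V G : Submodule k (MvPolynomial σ k)}
    (hV : V ≤ homogeneousSubmodule σ k δ) (hG : G ≤ V) {n : ℕ}
    (h : ((V ^ (n + 1) : Submodule k (MvPolynomial σ k)) : Set (MvPolynomial σ k)) ⊆
      (idealOfVars σ k * Ideal.span (V : Set (MvPolynomial σ k)) ^ (n + 1) ⊔
        Ideal.span (G : Set (MvPolynomial σ k)) * Ideal.span (V : Set (MvPolynomial σ k)) ^ n :
        Ideal (MvPolynomial σ k))) :
    V ^ (n + 1) ≤ G * V ^ n := by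
  intro p hp
  have hVn := pow_le_homogeneousSubmodule hV (n + 1)
  have hGV : G * V ^ n ≤ homogeneousSubmodule σ k ((n + 1) * δ) := by
    rw [pow_succ'] at hVn
    exact (mul_le_mul' hG le_rfl).trans hVn
  obtain ⟨b, hb, a, ha, rfl⟩ := Submodule.mem_sup.1 (h hp)
  rw [← span_coe_pow] at hb
  rw [← span_coe_pow, ← span_coe_mul] at ha
  rw [← homogeneousComponent_eq_self (hVn hp), map_add, homogeneousComponent_eq_zero_of_mem hVn hb,
    zero_add]
  exact (homogeneousComponent_mem_of_mem_span hGV ha).1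

attribute [local instance] MvPolynomial.gradedAlgebra

/-- A homogeneous reduction is a reduction already by its part in the degree of the generators. -/
theorem exists_pow_succ_le_of_isReductionOf {δ : ℕ} {V : Submodule k (MvPolynomial σ k)}
    (hV : V ≤ homogeneousSubmodule σ k δ) {K : Ideal (MvPolynomial σ k)}
    (hK : K.IsHomogeneous (homogeneousSubmodule σ k))
    (hred : IsReductionOf K (Ideal.span (V : Set (MvPolynomial σ k)))) :
    ∃ n : ℕ, V ^ (n + 1) ≤ (K.restrictScalars k ⊓ V) * V ^ n := by
  obtain ⟨hle, n, hn⟩ := hred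
  refine ⟨n, pow_succ_le_mul_pow_of_subset hV inf_le_right ?_⟩
  set W : Submodule k (MvPolynomial σ k) := K.restrictScalars k ⊓ V with hW
  -- modulo `𝔪 I`, an element of `K` equals its component of degree `δ`, which is again in `K`
  have hKW : K ≤ idealOfVars σ k * Ideal.span (V : Set (MvPolynomial σ k)) ⊔
      Ideal.span (W : Set (MvPolynomial σ k)) := by
    intro p hp
    obtain ⟨h1, h2⟩ := homogeneousComponent_mem_of_mem_span hV (hle hp)
    rw [← sub_add_cancel p (homogeneousComponent δ p)]
    exact add_mem (Ideal.mem_sup_left h2) (Ideal.mem_sup_right (Ideal.subset_span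
      ⟨homogeneousComponent_mem_of_mem hK hp δ, h1⟩))
  intro p hp
  have hp' : p ∈ Ideal.span (V : Set (MvPolynomial σ k)) ^ (n + 1) := by
    rw [← span_coe_pow]; exact Ideal.subset_span hp
  rw [hn] at hp'
  have := Ideal.mul_mono_left hKW hp'
  rwa [Ideal.sup_mul, mul_assoc, ← pow_succ'] at this

end GradedNakayama

/-! ### Integrality over a subalgebra generated by linear forms -/

section IntegralityOverLinearForms

variable {k F : Type*} [Field k] [CommRing F] [Algebra k F]

/-- If an algebra generated by `U` satisfies `U ^ (n + 1) ≤ U' * U ^ n`, then the powers `U ^ i`,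
`i ≤ n`, generate it as a module over the subalgebra generated by `U'`. -/
theorem isIntegral_adjoin_of_pow_succ_le {U U' : Submodule k F} (hfg : U.FG)
    (htop : Algebra.adjoin k (U : Set F) = ⊤) {n : ℕ} (h : U ^ (n + 1) ≤ U' * U ^ n) (b : F) :
    IsIntegral (Algebra.adjoin k (U' : Set F)) b := by
  set A := Algebra.adjoin k (U' : Set F) with hA
  set M : Submodule A F :=
    ⨆ i : Fin (n + 1), Submodule.span A ((U ^ (i : ℕ) : Submodule k F) : Set F)
    with hM
  have hmem : ∀ i ≤ n, ∀ x ∈ U ^ i, x ∈ M := fun i hi x hx =>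
    Submodule.mem_iSup_of_mem (⟨i, Nat.lt_succ_of_le hi⟩ : Fin (n + 1)) (Submodule.subset_span hx)
  have hU : ∀ u ∈ U, ∀ x ∈ M, u * x ∈ M := by
    intro u hu x hx
    induction hx using Submodule.iSup_induction' with
    | zero => simp
    | add x y _ _ hx hy => rw [mul_add]; exact add_mem hx hy
    | mem i x hx =>
      induction hx using Submodule.span_induction with
      | zero => simp
      | add x y _ _ hx hy => rw [mul_add]; exact add_mem hx hy
      | smul a x _ hx => rw [mul_smul_comm]; exact M.smul_mem a hx
      | mem x hx =>
        have hux : u * x ∈ U ^ ((i : ℕ) + 1) := by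
          rw [pow_succ']; exact Submodule.mul_mem_mul hu hx
        rcases Nat.lt_or_ge i n with hi | hi
        · exact hmem _ hi _ hux
        · rw [le_antisymm (Nat.lt_succ_iff.1 i.2) hi] at hux
          refine Submodule.mul_induction_on (h hux) (fun a ha y hy => ?_) fun _ _ => add_mem
          exact M.smul_mem (⟨a, Algebra.subset_adjoin ha⟩ : A) (hmem n le_rfl y hy)
  have hall : ∀ a : F, ∀ x ∈ M, a * x ∈ M := by
    intro a
    have ha : a ∈ Algebra.adjoin k (U : Set F) := htop ▸ Algebra.mem_top
    induction ha using Algebra.adjoin_induction with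
    | mem u hu => exact hU u hu
    | algebraMap c =>
      intro x hx
      exact M.smul_mem (algebraMap k A c) hx
    | add a b _ _ ha hb => intro x hx; rw [add_mul]; exact add_mem (ha x hx) (hb x hx)
    | mul a b _ _ ha hb => intro x hx; rw [mul_assoc]; exact ha _ (hb x hx)
  have hMtop : M = ⊤ := by
    refine Submodule.eq_top_iff'.2 fun a => ?_
    have h1 : (1 : F) ∈ M := hmem 0 (Nat.zero_le n) 1 (by
      rw [pow_zero]; exact Submodule.one_le.1 le_rfl)
    simpa using hall a 1 h1
  have hMfg : M.FG := by
    refine Submodule.fg_iSup _ fun i => ?_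
    obtain ⟨s, hs⟩ := hfg.pow i
    rw [← hs, Submodule.span_span_of_tower]
    exact ⟨s, rfl⟩
  have : Module.Finite A F := ⟨hMtop ▸ hMfg⟩
  exact IsIntegral.of_finite A b

/-- Modulo the elements `w i`, an element that is integral over the subalgebra they generate
satisfies a monic equation with coefficients in `k`. -/
theorem exists_monic_aeval_mem_span {ι : Type*} {w : ι → F} {b : F}
    (hb : IsIntegral (Algebra.adjoin k (Set.range w)) b) :
    ∃ h : Polynomial k, h.Monic ∧ Polynomial.aeval b h ∈ Ideal.span (Set.range w) := by
  set A := Algebra.adjoin k (Set.range w)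
  let φ : F →ₐ[k] F ⧸ Ideal.span (Set.range w) := Ideal.Quotient.mkₐ k _
  have hA : A ≤ (⊥ : Subalgebra k _).comap φ := Algebra.adjoin_le <| by
    rintro _ ⟨i, rfl⟩
    have : φ (w i) = 0 := Ideal.Quotient.eq_zero_iff_mem.2 (Ideal.subset_span ⟨i, rfl⟩)
    rw [SetLike.mem_coe, Subalgebra.mem_comap, this]
    exact zero_mem _
  let g : A →ₐ[k] (⊥ : Subalgebra k (F ⧸ Ideal.span (Set.range w))) :=
    (φ.comp A.val).codRestrict ⊥ fun x => hA x.2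
  have hint : IsIntegral (⊥ : Subalgebra k (F ⧸ Ideal.span (Set.range w))) (φ b) := by
    obtain ⟨p, hp, hpb⟩ := hb
    refine ⟨p.map g.toRingHom, hp.map _, ?_⟩
    rw [Polynomial.eval₂_map]
    have := congrArg φ hpb
    rw [map_zero] at this
    rw [← this]
    exact (Polynomial.hom_eval₂ p (algebraMap A F) φ.toRingHom b).symm
  have : Algebra.IsIntegral k (⊥ : Subalgebra k (F ⧸ Ideal.span (Set.range w))) := by
    refine ⟨?_⟩
    rintro ⟨x, hx⟩
    obtain ⟨c, rfl⟩ := Algebra.mem_bot.1 hx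
    exact isIntegral_algebraMap (x := c)
  obtain ⟨h, hh, hhb⟩ := isIntegral_trans (R := k) (φ b) hint
  refine ⟨h, hh, ?_⟩
  rw [← Ideal.Quotient.eq_zero_iff_mem]
  rw [← Polynomial.aeval_def, Polynomial.aeval_algHom_apply] at hhb
  exact hhb

end IntegralityOverLinearForms

/-! ### The Rees algebra and the special fiber ring -/

section ReesAlgebra

/-- The submodule `V * t ^ n` of the polynomial ring `R[t]`. -/
noncomputable def gradedPiece {k R : Type*} [CommRing k] [CommRing R] [Algebra k R] (n : ℕ)
    (V : Submodule k R) : Submodule k (Polynomial R) :=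
  V.map ((Polynomial.monomial n : R →ₗ[R] Polynomial R).restrictScalars k)

theorem mem_gradedPiece {k R : Type*} [CommRing k] [CommRing R] [Algebra k R] {n : ℕ}
    {V : Submodule k R} {p : Polynomial R} :
    p ∈ gradedPiece n V ↔ ∃ v ∈ V, Polynomial.monomial n v = p := Iff.rfl

theorem gradedPiece_mul {k R : Type*} [CommRing k] [CommRing R] [Algebra k R] (m n : ℕ)
    (V W : Submodule k R) : gradedPiece m V * gradedPiece n W = gradedPiece (m + n) (V * W) := by
  apply le_antisymm
  · rw [Submodule.mul_le]
    rintro _ ⟨v, hv, rfl⟩ _ ⟨w, hw, rfl⟩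
    exact mem_gradedPiece.2
      ⟨v * w, Submodule.mul_mem_mul hv hw, (Polynomial.monomial_mul_monomial m n v w).symm⟩
  · rw [gradedPiece, Submodule.map_le_iff_le_comap, Submodule.mul_le]
    intro v hv w hw
    have : Polynomial.monomial m v * Polynomial.monomial n w ∈ gradedPiece m V * gradedPiece n W :=
      Submodule.mul_mem_mul ⟨v, hv, rfl⟩ ⟨w, hw, rfl⟩
    rwa [Polynomial.monomial_mul_monomial] at this

theorem gradedPiece_pow {k R : Type*} [CommRing k] [CommRing R] [Algebra k R]
    (V : Submodule k R) (n : ℕ) : gradedPiece 1 V ^ n = gradedPiece n (V ^ n) := by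
  induction n with
  | zero =>
    rw [pow_zero, pow_zero, gradedPiece]
    ext p
    simp only [Submodule.mem_one, Submodule.mem_map]
    constructor
    · rintro ⟨c, rfl⟩
      exact ⟨_, ⟨c, rfl⟩, rfl⟩
    · rintro ⟨_, ⟨c, rfl⟩, rfl⟩
      exact ⟨c, rfl⟩
  | succ n ih => rw [pow_succ, pow_succ, ih, gradedPiece_mul]

theorem gradedPiece_mono {k R : Type*} [CommRing k] [CommRing R] [Algebra k R] (n : ℕ)
    {V W : Submodule k R} (h : V ≤ W) : gradedPiece n V ≤ gradedPiece n W :=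
  Submodule.map_mono h

/-- The inclusion of the Rees algebra into `R[t]`, over a base ring `k` of `R`. -/
noncomputable def reesVal (k : Type*) {R : Type*} [CommRing k] [CommRing R] [Algebra k R]
    (I : Ideal R) : reesAlgebra I →ₐ[k] Polynomial R :=
  (reesAlgebra I).val.restrictScalars k

theorem reesVal_injective (k : Type*) {R : Type*} [CommRing k] [CommRing R] [Algebra k R]
    (I : Ideal R) : Function.Injective (reesVal k I) := Subtype.val_injective

/-- The submodule `V * t` of the Rees algebra of an ideal `I`, for `V ⊆ I`. -/
noncomputable def reesLinear {k R : Type*} [CommRing k] [CommRing R] [Algebra k R] (I : Ideal R)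
    (V : Submodule k R) : Submodule k (reesAlgebra I) :=
  (gradedPiece 1 V).comap (reesVal k I).toLinearMap

section

variable {k R : Type*} [CommRing k] [CommRing R] [Algebra k R] {I : Ideal R} {V W : Submodule k R}

theorem map_reesLinear (hV : V ≤ I.restrictScalars k) :
    (reesLinear I V).map (reesVal k I).toLinearMap = gradedPiece 1 V := by
  rw [reesLinear, Submodule.map_comap_eq, inf_eq_right]
  rintro _ ⟨v, hv, rfl⟩
  exact ⟨⟨Polynomial.monomial 1 v, reesAlgebra.monomial_mem.2 (by simpa using hV hv)⟩, rfl⟩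

theorem map_reesLinear_pow (hV : V ≤ I.restrictScalars k) (n : ℕ) :
    ((reesLinear I V) ^ n).map (reesVal k I).toLinearMap = gradedPiece n (V ^ n) := by
  rw [Submodule.map_pow, map_reesLinear hV, gradedPiece_pow]

theorem mem_reesLinear_pow (hV : V ≤ I.restrictScalars k) {n : ℕ} {v : R} (hv : v ∈ V ^ n)
    {x : reesAlgebra I} (hx : (x : Polynomial R) = Polynomial.monomial n v) :
    x ∈ reesLinear I V ^ n := by
  have : (Polynomial.monomial n v) ∈ ((reesLinear I V) ^ n).map (reesVal k I).toLinearMap := by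
    rw [map_reesLinear_pow hV]
    exact mem_gradedPiece.2 ⟨v, hv, rfl⟩
  obtain ⟨y, hy, hyx⟩ := this
  rwa [← reesVal_injective k I (hyx.trans hx.symm)]

theorem reesLinear_pow_succ_le (hV : V ≤ I.restrictScalars k) (hW : W ≤ V) {n : ℕ}
    (h : V ^ (n + 1) ≤ W * V ^ n) :
    reesLinear I V ^ (n + 1) ≤ reesLinear I W * reesLinear I V ^ n := by
  rw [← Submodule.map_le_map_iff_of_injective (f := (reesVal k I).toLinearMap)
    (reesVal_injective k I), map_reesLinear_pow hV, Submodule.map_mul, map_reesLinear (hW.trans hV),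
    map_reesLinear_pow hV, gradedPiece_mul, add_comm 1 n]
  exact gradedPiece_mono _ h

theorem fg_reesLinear (hV : V ≤ I.restrictScalars k) (hfg : V.FG) : (reesLinear I V).FG := by
  refine Submodule.fg_of_fg_map_injective (reesVal k I).toLinearMap (reesVal_injective k I) ?_
  rw [map_reesLinear hV]
  exact hfg.map _

end

variable {σ k : Type*} [Field k] {I : Ideal (MvPolynomial σ k)} {δ : ℕ}
  {V : Submodule k (MvPolynomial σ k)}

variable {F : Type*} [CommRing F] [Algebra k F] {π : reesAlgebra I →ₐ[k] F}

theorem fiber_monomial_eq_zero (hker : ∀ x, π x = 0 ↔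
      x ∈ (idealOfVars σ k).map (algebraMap (MvPolynomial σ k) (reesAlgebra I)))
    {n : ℕ} {p : MvPolynomial σ k}
    (hp : p ∈ idealOfVars σ k * I ^ n) :
    ∀ h : Polynomial.monomial n p ∈ reesAlgebra I, π ⟨Polynomial.monomial n p, h⟩ = 0 := by
  induction hp using Submodule.mul_induction_on' with
  | mem_mul_mem r hr s hs =>
    intro h
    have : (⟨Polynomial.monomial n (r * s), h⟩ : reesAlgebra I) =
        algebraMap _ (reesAlgebra I) r *
          ⟨Polynomial.monomial n s, reesAlgebra.monomial_mem.2 hs⟩ := by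
      refine Subtype.ext ?_
      change Polynomial.monomial n (r * s) = Polynomial.C r * Polynomial.monomial n s
      rw [Polynomial.C_mul_monomial]
    rw [hker, this]
    exact Ideal.mul_mem_right _ _ (Ideal.mem_map_of_mem _ hr)
  | add y hy z hz hy' hz' =>
    intro h
    have hy0 : y ∈ I ^ n := (Ideal.mul_le_right : idealOfVars σ k * I ^ n ≤ I ^ n) hy
    have hz0 : z ∈ I ^ n := (Ideal.mul_le_right : idealOfVars σ k * I ^ n ≤ I ^ n) hz
    have hy1 := reesAlgebra.monomial_mem.2 hy0
    have hz1 := reesAlgebra.monomial_mem.2 hz0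
    have : (⟨Polynomial.monomial n (y + z), h⟩ : reesAlgebra I) =
        ⟨Polynomial.monomial n y, hy1⟩ + ⟨Polynomial.monomial n z, hz1⟩ :=
      Subtype.ext (map_add _ _ _)
    rw [this, map_add, hy' hy1, hz' hz1, add_zero]

/-- The special fiber ring of an ideal generated by forms `V` of the same degree is generated by its
forms of degree one. -/
theorem adjoin_map_reesLinear (hπ : Function.Surjective π)
    (hker : ∀ x, π x = 0 ↔
      x ∈ (idealOfVars σ k).map (algebraMap (MvPolynomial σ k) (reesAlgebra I)))
    (hV : V ≤ homogeneousSubmodule σ k δ)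
    (hI : Ideal.span (V : Set (MvPolynomial σ k)) = I) :
    Algebra.adjoin k ((reesLinear I V).map π.toLinearMap : Set F) =
      ⊤ := by
  have hVI : V ≤ I.restrictScalars k := fun v hv => by
    rw [← hI]; exact Ideal.subset_span hv
  set B := Algebra.adjoin k ((reesLinear I V).map π.toLinearMap : Set F)
    with hB
  have hle : ∀ n, ((reesLinear I V).map π.toLinearMap) ^ n ≤ Subalgebra.toSubmodule B := by
    intro n
    induction n with
    | zero => rw [pow_zero, Submodule.one_le]; exact B.one_mem
    | succ n ih =>
      rw [pow_succ, Submodule.mul_le]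
      exact fun a ha b hb => B.mul_mem (ih ha) (Algebra.subset_adjoin hb)
  have hpow : ∀ n, ∀ x ∈ reesLinear I V ^ n, π x ∈ B := by
    intro n x hx
    have h1 : π x ∈ (reesLinear I V ^ n).map π.toLinearMap := ⟨x, hx, rfl⟩
    rw [Submodule.map_pow] at h1
    exact hle n h1
  have hmon : ∀ n p, ∀ h : Polynomial.monomial n p ∈ reesAlgebra I,
      π ⟨Polynomial.monomial n p, h⟩ ∈ B := by
    intro n p h
    have hp : p ∈ Ideal.span ((V ^ n : Submodule k _) : Set (MvPolynomial σ k)) := by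
      rw [span_coe_pow, hI]; exact reesAlgebra.monomial_mem.1 h
    obtain ⟨h1, h2⟩ := homogeneousComponent_mem_of_mem_span (pow_le_homogeneousSubmodule hV n) hp
    rw [span_coe_pow, hI] at h2
    set q := homogeneousComponent (n * δ) p
    have hq : q ∈ I ^ n := by
      rw [← hI, ← span_coe_pow]; exact Ideal.subset_span h1
    have h3 := reesAlgebra.monomial_mem.2 hq
    have h2' : p - q ∈ I ^ n := (Ideal.mul_le_right : idealOfVars σ k * I ^ n ≤ I ^ n) h2
    have h4 := reesAlgebra.monomial_mem.2 h2'
    have : (⟨Polynomial.monomial n p, h⟩ : reesAlgebra I) =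
        ⟨Polynomial.monomial n (p - q), h4⟩ + ⟨Polynomial.monomial n q, h3⟩ :=
      Subtype.ext (by
        rw [AddMemClass.coe_add]
        change _ = Polynomial.monomial n (p - q) + Polynomial.monomial n q
        rw [← map_add, sub_add_cancel])
    rw [this, map_add, fiber_monomial_eq_zero hker h2, zero_add]
    exact hpow n _ (mem_reesLinear_pow hVI h1 rfl)
  refine eq_top_iff.2 fun y _ => ?_
  obtain ⟨x, rfl⟩ := hπ y
  have hmem : ∀ i,
      Polynomial.monomial i ((x : Polynomial (MvPolynomial σ k)).coeff i) ∈ reesAlgebra I :=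
    fun i => reesAlgebra.monomial_mem.2 (x.2 i)
  have : x = ∑ i ∈ (x : Polynomial (MvPolynomial σ k)).support, ⟨_, hmem i⟩ := by
    refine Subtype.ext ?_
    rw [AddSubmonoidClass.coe_finsetSum]
    exact (x : Polynomial (MvPolynomial σ k)).as_sum_support
  rw [this, map_sum]
  exact sum_mem fun i _ => hmon i _ _

/-- The ideal of the Rees algebra of `I` whose component in degree `n + 1` consists of the elements
of `𝔪 I ^ (n + 1) + J I ^ n`, for an ideal `J ⊆ I`. -/
def fiberIdeal (I J : Ideal (MvPolynomial σ k)) : Ideal (reesAlgebra I) where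
  carrier := {x | (x : Polynomial (MvPolynomial σ k)).coeff 0 ∈ idealOfVars σ k ∧
    ∀ n, (x : Polynomial (MvPolynomial σ k)).coeff (n + 1) ∈
      idealOfVars σ k * I ^ (n + 1) ⊔ J * I ^ n}
  zero_mem' := by simp
  add_mem' hx hy := by
    refine ⟨?_, fun n => ?_⟩
    · rw [AddMemClass.coe_add, Polynomial.coeff_add]; exact add_mem hx.1 hy.1
    · rw [AddMemClass.coe_add, Polynomial.coeff_add]; exact add_mem (hx.2 n) (hy.2 n)
  smul_mem' p x hx := by
    rw [smul_eq_mul]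
    refine ⟨?_, fun n => ?_⟩
    · rw [MulMemClass.coe_mul, Polynomial.mul_coeff_zero]; exact Ideal.mul_mem_left _ _ hx.1
    · rw [MulMemClass.coe_mul, Polynomial.coeff_mul]
      refine sum_mem ?_
      rintro ⟨i, j⟩ hij
      rw [Finset.HasAntidiagonal.mem_antidiagonal] at hij
      dsimp only at hij ⊢
      have hp := p.2 i
      cases j with
      | zero =>
        rw [add_zero] at hij
        subst hij
        rw [mul_comm (Polynomial.coeff _ _)]
        exact Ideal.mem_sup_left (Ideal.mul_mem_mul hx.1 hp)
      | succ j =>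
        obtain rfl : n = i + j := by omega
        have h := Ideal.mul_mem_mul hp (hx.2 j)
        rw [Ideal.mul_sup, mul_left_comm, mul_left_comm _ J, ← pow_add, ← pow_add] at h
        exact h

theorem map_idealOfVars_le_fiberIdeal (I J : Ideal (MvPolynomial σ k)) :
    (idealOfVars σ k).map (algebraMap (MvPolynomial σ k) (reesAlgebra I)) ≤ fiberIdeal I J := by
  refine Ideal.map_le_iff_le_comap.2 fun a ha => ⟨?_, fun n => ?_⟩
  · change (Polynomial.C a).coeff 0 ∈ _
    rwa [Polynomial.coeff_C_zero]
  · change (Polynomial.C a).coeff (n + 1) ∈ _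
    rw [Polynomial.coeff_C_succ]
    exact zero_mem _

/-- If the special fiber ring is integral over the subalgebra generated by the linear forms coming
from `g`, then `g` generates a reduction. -/
theorem exists_pow_succ_le_of_isIntegral [Finite σ] (hπ : Function.Surjective π)
    (hker : ∀ x, π x = 0 ↔
      x ∈ (idealOfVars σ k).map (algebraMap (MvPolynomial σ k) (reesAlgebra I)))
    (hV : V ≤ homogeneousSubmodule σ k δ)
    (hI : Ideal.span (V : Set (MvPolynomial σ k)) = I) {ι : Type*} {g : ι → MvPolynomial σ k}
    (hg : ∀ i, g i ∈ V) {x : ι → reesAlgebra I}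
    (hx : ∀ i, (x i : Polynomial (MvPolynomial σ k)) = Polynomial.monomial 1 (g i))
    (hint : ∀ b : F,
      IsIntegral (Algebra.adjoin k (Set.range fun i => π (x i))) b) :
    ∃ n : ℕ, V ^ (n + 1) ≤ Submodule.span k (Set.range g) * V ^ n := by
  have hVI : V ≤ I.restrictScalars k := fun v hv => by
    rw [← hI]; exact Ideal.subset_span hv
  set J : Ideal (MvPolynomial σ k) :=
    Ideal.span (Submodule.span k (Set.range g) : Set (MvPolynomial σ k)) with hJ
  have hxJ : Ideal.span (Set.range x) ≤ fiberIdeal I J := by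
    refine Ideal.span_le.2 ?_
    rintro _ ⟨i, rfl⟩
    refine ⟨?_, fun n => ?_⟩
    · rw [hx, Polynomial.coeff_monomial, if_neg one_ne_zero]; exact zero_mem _
    · rw [hx, Polynomial.coeff_monomial]
      split_ifs with h
      · obtain rfl : n = 0 := by omega
        refine Ideal.mem_sup_right ?_
        rw [pow_zero, mul_one]
        exact Ideal.subset_span (Submodule.subset_span ⟨i, rfl⟩)
      · exact zero_mem _
  -- the top coefficient of a monic equation for `v t` modulo the ideal is a power of `v`
  have hrad : Ideal.span (reesLinear I V : Set (reesAlgebra I)) ≤ (fiberIdeal I J).radical := by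
    refine Ideal.span_le.2 fun y hy => ?_
    obtain ⟨v, hv, hvy⟩ := hy
    change Polynomial.monomial 1 v = (y : Polynomial (MvPolynomial σ k)) at hvy
    obtain ⟨h, hh, hhy⟩ := exists_monic_aeval_mem_span (hint (π y))
    have hmem : Polynomial.aeval y h ∈ fiberIdeal I J := by
      rw [Polynomial.aeval_algHom_apply,
        show (Set.range fun i => π (x i)) = π '' Set.range x from Set.range_comp π x,
        ← Ideal.map_span, Ideal.mem_map_iff_of_surjective _ hπ] at hhy
      obtain ⟨z, hz, hzy⟩ := hhy
      rw [eq_comm, ← sub_eq_zero, ← map_sub, hker] at hzy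
      rw [← sub_add_cancel (Polynomial.aeval y h) z]
      exact add_mem (map_idealOfVars_le_fiberIdeal I J hzy) (hxJ hz)
    -- the extra factor `y` makes the leading degree positive
    have hmem2 := Ideal.mul_mem_left _ y hmem
    have hcoe : ∀ n, ((y ^ n : reesAlgebra I) : Polynomial (MvPolynomial σ k)) =
        Polynomial.monomial n (v ^ n) := fun n => by
      rw [SubmonoidClass.coe_pow, ← hvy, Polynomial.monomial_pow, one_mul]
    have hcoef : ((y * Polynomial.aeval y h : reesAlgebra I) : Polynomial (MvPolynomial σ k)).coeff
        (h.natDegree + 1) = v ^ (h.natDegree + 1) := by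
      have : ((Polynomial.aeval y h : reesAlgebra I) : Polynomial (MvPolynomial σ k)).coeff
          h.natDegree = v ^ h.natDegree := by
        rw [Polynomial.aeval_eq_sum_range, AddSubmonoidClass.coe_finsetSum,
          Polynomial.finsetSum_coeff, Finset.sum_range_succ, Finset.sum_eq_zero, zero_add]
        · rw [hh.coeff_natDegree, one_smul, hcoe, Polynomial.coeff_monomial, if_pos rfl]
        · intro i hi
          change (h.coeff i • ((y ^ i : reesAlgebra I) : Polynomial (MvPolynomial σ k))).coeff _ = 0
          rw [hcoe, Polynomial.coeff_smul, Polynomial.coeff_monomial,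
            if_neg (Finset.mem_range.1 hi).ne, smul_zero]
      rw [MulMemClass.coe_mul, ← hvy, Polynomial.coeff_monomial_mul, this, pow_succ']
    have hvm := hmem2.2 h.natDegree
    rw [hcoef] at hvm
    refine ⟨h.natDegree + 1, ?_, fun n => ?_⟩
    · rw [hcoe, Polynomial.coeff_monomial, if_neg (Nat.succ_ne_zero _)]
      exact zero_mem _
    · rw [hcoe, Polynomial.coeff_monomial]
      split_ifs with hn
      · obtain rfl : h.natDegree = n := by omega
        exact hvm
      · exact zero_mem _
  obtain ⟨n, hn⟩ := Ideal.exists_pow_le_of_le_radical_of_fg hrad (IsNoetherian.noetherian _)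
  refine ⟨n, pow_succ_le_mul_pow_of_subset hV (Submodule.span_le.2 (Set.range_subset_iff.2 hg)) ?_⟩
  intro p hp
  have hpI : p ∈ I ^ (n + 1) := by
    rw [← hI, ← span_coe_pow]; exact Ideal.subset_span hp
  let z : reesAlgebra I := ⟨Polynomial.monomial (n + 1) p, reesAlgebra.monomial_mem.2 hpI⟩
  have hz : z ∈ Ideal.span (reesLinear I V : Set (reesAlgebra I)) ^ (n + 1) := by
    rw [← span_coe_pow]
    exact Ideal.subset_span (mem_reesLinear_pow hVI hp rfl)
  have := (hn (Ideal.pow_le_pow_right (Nat.le_succ n) hz)).2 n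
  change (Polynomial.monomial (n + 1) p).coeff (n + 1) ∈ _ at this
  rw [Polynomial.coeff_monomial, if_pos rfl] at this
  rwa [hI]

attribute [local instance] MvPolynomial.gradedAlgebra

/-- A homogeneous reduction of an ideal generated by forms `V` of the same degree contains a
reduction generated by `ℓ` elements of `V`, where `ℓ` is the dimension of the special fiber ring,
given here as any ring `F` with a surjection from the Rees algebra whose kernel is generated by the
variables. -/
theorem exists_reduction_of_ringKrullDim [Finite σ] [Infinite k] {ℓ : ℕ}
    (hπ : Function.Surjective π)
    (hker : ∀ x, π x = 0 ↔
      x ∈ (idealOfVars σ k).map (algebraMap (MvPolynomial σ k) (reesAlgebra I)))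
    (hV : V ≤ homogeneousSubmodule σ k δ) (hfg : V.FG)
    (hI : Ideal.span (V : Set (MvPolynomial σ k)) = I) (hℓ : ringKrullDim F = ℓ)
    {K : Ideal (MvPolynomial σ k)} (hK : K.IsHomogeneous (homogeneousSubmodule σ k))
    (hred : IsReductionOf K I) :
    ∃ g : Fin ℓ → MvPolynomial σ k, (∀ i, g i ∈ K ∧ g i ∈ V) ∧
      ∃ n : ℕ, V ^ (n + 1) ≤ Submodule.span k (Set.range g) * V ^ n := by
  have hVI : V ≤ I.restrictScalars k := fun v hv => by
    rw [← hI]; exact Ideal.subset_span hv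
  rw [← hI] at hred
  obtain ⟨n, hn⟩ := exists_pow_succ_le_of_isReductionOf hV hK hred
  set W : Submodule k (MvPolynomial σ k) := K.restrictScalars k ⊓ V with hW
  have hWfg : W.FG := by
    have := Module.Finite.iff_fg.2 hfg
    have : FiniteDimensional k W := Submodule.finiteDimensional_of_le inf_le_right
    exact Module.Finite.iff_fg.1 this
  have hU : (reesLinear I V).map π.toLinearMap ^ (n + 1) ≤
      (reesLinear I W).map π.toLinearMap * (reesLinear I V).map π.toLinearMap ^ n := by
    rw [← Submodule.map_pow, ← Submodule.map_pow, ← Submodule.map_mul]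
    exact Submodule.map_mono (reesLinear_pow_succ_le hVI inf_le_right hn)
  have hint := isIntegral_adjoin_of_pow_succ_le ((fg_reesLinear hVI hfg).map _)
    (adjoin_map_reesLinear hπ hker hV hI) hU
  obtain ⟨m, y, hy⟩ := Submodule.fg_iff_exists_fin_generating_family.1
    ((fg_reesLinear (inf_le_right.trans hVI) hWfg).map π.toLinearMap)
  rw [← hy, Algebra.adjoin_span] at hint
  obtain ⟨w, hw, hwint⟩ := exists_isIntegral_adjoin_of_ringKrullDim hℓ y hint
  rw [hy] at hw
  choose x hx hxw using hw
  choose g hg hgx using hx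
  refine ⟨g, fun i => hg i, exists_pow_succ_le_of_isIntegral hπ hker hV hI (fun i => (hg i).2)
    (x := x) (fun i => (hgx i).symm) ?_⟩
  have : (fun i => π (x i)) = w := funext hxw
  rwa [this]

/-- A homogeneous reduction of an ideal generated by forms `V` of the same degree contains a
reduction generated by `ℓ` elements of `V`, where `ℓ` is the analytic spread. -/
theorem exists_reduction_of_analyticSpread [Finite σ] [Infinite k] {ℓ : ℕ}
    (hV : V ≤ homogeneousSubmodule σ k δ) (hfg : V.FG)
    (hI : Ideal.span (V : Set (MvPolynomial σ k)) = I) (hℓ : analyticSpread I = ℓ)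
    {K : Ideal (MvPolynomial σ k)} (hK : K.IsHomogeneous (homogeneousSubmodule σ k))
    (hred : IsReductionOf K I) :
    ∃ g : Fin ℓ → MvPolynomial σ k, (∀ i, g i ∈ K ∧ g i ∈ V) ∧
      ∃ n : ℕ, V ^ (n + 1) ≤ Submodule.span k (Set.range g) * V ^ n := by
  let 𝔪 : Ideal (reesAlgebra I) :=
    (idealOfVars σ k).map (algebraMap (MvPolynomial σ k) (reesAlgebra I))
  let π : reesAlgebra I →ₐ[k] (reesAlgebra I ⧸ 𝔪) := Ideal.Quotient.mkₐ k 𝔪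
  have h1 : Function.Surjective π := Ideal.Quotient.mkₐ_surjective k 𝔪
  have h2 : ringKrullDim (reesAlgebra I ⧸ 𝔪) = ℓ := hℓ
  have h3 : ∀ x, π x = 0 ↔ x ∈ 𝔪 := fun x => Ideal.Quotient.eq_zero_iff_mem
  have h := exists_reduction_of_ringKrullDim (F := reesAlgebra I ⧸ 𝔪) h1 h3 hV hfg hI h2 hK hred
  exact h

end ReesAlgebra

/-! ### Torus actions and terms of polynomials -/

section Torus

/-- A submodule over an infinite field that contains the transforms of `p` under the rescalings of
the variables by nonzero scalars contains all terms of `p`. -/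
theorem monomial_coeff_mem_of_forall_rescale {σ k A : Type*} [Field k] [Infinite k]
    [CommRing A] [Algebra k A] (M : Submodule k (MvPolynomial σ A)) (p : MvPolynomial σ A)
    (h : ∀ a : σ → k, (∀ i, a i ≠ 0) → aeval (fun i => C (algebraMap k A (a i)) * X i) p ∈ M)
    (e : σ →₀ ℕ) : monomial e (coeff e p) ∈ M := by
  classical
  by_contra hne
  -- a linear functional that vanishes on `M` but not on the term of exponent `e`
  obtain ⟨φ, hφ, hφM⟩ := Submodule.exists_le_ker_of_notMem hne
  set q : MvPolynomial σ k := ∑ m ∈ p.support, monomial m (φ (monomial m (coeff m p))) with hq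
  have hq0 : q = 0 := by
    refine MvPolynomial.funext_set (fun _ => ({0}ᶜ : Set k))
      (fun _ => (Set.finite_singleton 0).infinite_compl) fun a ha => ?_
    have ha' : ∀ i, a i ≠ 0 := fun i => ha i (Set.mem_univ i)
    have h1 := hφM (h a ha')
    rw [LinearMap.mem_ker, p.as_sum, map_sum, map_sum] at h1
    rw [map_zero, hq, map_sum, ← h1]
    refine Finset.sum_congr rfl fun m _ => ?_
    have : aeval (fun i => C (algebraMap k A (a i)) * X i) (monomial m (coeff m p)) =
        (m.prod fun i n => a i ^ n) • monomial m (coeff m p) := by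
      rw [aeval_monomial, monomial_eq, Algebra.smul_def]
      simp only [mul_pow, Finsupp.prod, Finset.prod_mul_distrib, MvPolynomial.algebraMap_apply,
        map_prod, map_pow, Algebra.algebraMap_self, RingHom.id_apply]
      ring
    rw [this, map_smul, eval_monomial, smul_eq_mul, mul_comm]
  have := congrArg (coeff e) hq0
  rw [hq, coeff_sum, coeff_zero] at this
  simp only [coeff_monomial] at this
  rw [Finset.sum_ite_eq'] at this
  split_ifs at this with hs
  · exact hφ this
  · rw [notMem_support_iff] at hs
    rw [hs, monomial_zero] at hne
    exact hne (zero_mem _)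

end Torus

/-! ### Monomials in general specializations -/

section Specialization

/-- Leading monomials under specialization: outside the zero locus of the leading coefficients of
finitely many elements whose leading exponents generate all leading exponents of `J`, the
specialization of `J` has no new leading exponents. -/
theorem exists_forall_degree_map_eq {ρ A : Type*} [Finite ρ] [CommRing A] [IsDomain A]
    (o : MonomialOrder ρ) (J : Ideal (MvPolynomial ρ A)) :
    ∃ q : A, q ≠ 0 ∧ ∀ {B : Type*} [CommRing B] [IsDomain B] (φ : A →+* B), φ q ≠ 0 →
      ∀ p ∈ J, map φ p ≠ 0 → ∃ g ∈ J, g ≠ 0 ∧ o.degree g = o.degree (map φ p) := by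
  classical
  set S : Set (ρ →₀ ℕ) := {e | ∃ g ∈ J, g ≠ 0 ∧ o.degree g = e} with hS
  set T : Set (ρ →₀ ℕ) := {e | Minimal (· ∈ S) e} with hT
  have hTfin : T.Finite := WellQuasiOrderedLE.finite_of_isAntichain (setOfPred_minimal_antichain _)
  have hch : ∀ e : ρ →₀ ℕ, ∃ g : MvPolynomial ρ A, e ∈ T → g ∈ J ∧ g ≠ 0 ∧ o.degree g = e := by
    intro e
    by_cases he : e ∈ T
    · obtain ⟨g, hg⟩ := he.prop
      exact ⟨g, fun _ => hg⟩
    · exact ⟨0, fun h => absurd h he⟩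
  choose g hg using hch
  refine ⟨∏ e ∈ hTfin.toFinset, o.leadingCoeff (g e), Finset.prod_ne_zero_iff.2 fun e he =>
    o.leadingCoeff_ne_zero_iff.2 (hg e (hTfin.mem_toFinset.1 he)).2.1, ?_⟩
  intro B _ _ φ hq p
  rw [map_prod, Finset.prod_ne_zero_iff] at hq
  induction hs : o.toSyn (o.degree p) using WellFoundedLT.induction generalizing p with
  | ind s ih =>
  intro hp hp0
  subst hs
  have hp1 : p ≠ 0 := by rintro rfl; exact hp0 (map_zero _)
  by_cases hlc : φ (o.leadingCoeff p) = 0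
  · -- the leading term of `p` is lost: cancel it against one of the chosen elements
    obtain ⟨t, hte, htT⟩ := exists_minimal_le_of_wellFoundedLT (· ∈ S) (o.degree p)
      ⟨p, hp, hp1, rfl⟩
    obtain ⟨hgJ, hg0, hgt⟩ := hg t htT
    have hgφ := hq t (hTfin.mem_toFinset.2 htT)
    set c := o.leadingCoeff (g t) with hc
    set p' := C c * p - monomial (o.degree p - t) (o.leadingCoeff p) * g t with hp'
    have hmap : map φ p' = C (φ c) * map φ p := by
      rw [hp', map_sub, map_mul, map_mul, map_C, map_monomial, hlc, monomial_zero, zero_mul,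
        sub_zero]
    have hmap0 : map φ p' ≠ 0 := by
      rw [hmap]; exact mul_ne_zero (C_ne_zero.2 hgφ) hp0
    have hdeg : o.degree (map φ p') = o.degree (map φ p) := by
      rw [hmap, o.degree_mul (C_ne_zero.2 hgφ) hp0, o.degree_C, zero_add]
    have hp'0 : p' ≠ 0 := by intro h; rw [h] at hmap0; exact hmap0 (map_zero _)
    have hlt : o.toSyn (o.degree p') < o.toSyn (o.degree p) := by
      refine lt_of_le_of_ne ?_ fun h => ?_
      · refine o.degree_sub_le.trans (sup_le ?_ ?_)
        · refine o.degree_mul_le.trans ?_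
          rw [o.degree_C, zero_add]
        · refine o.degree_mul_le.trans ?_
          rw [o.degree_monomial, if_neg (o.leadingCoeff_ne_zero_iff.2 hp1), hgt,
            tsub_add_cancel_of_le hte]
      · have h1 : coeff (o.degree p) p' = 0 := by
          have h2 : coeff (o.degree p) (monomial (o.degree p - t) (o.leadingCoeff p) * g t) =
              o.leadingCoeff p * c := by
            have h3 : o.degree p = (o.degree p - t) + t := (tsub_add_cancel_of_le hte).symm
            conv_lhs => rw [h3]
            rw [add_tsub_cancel_right, coeff_monomial_mul, hc, MonomialOrder.leadingCoeff,
              MonomialOrder.leadingCoeff, hgt]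
          rw [hp', coeff_sub, coeff_C_mul, h2, MonomialOrder.leadingCoeff, mul_comm, sub_self]
        rw [← o.toSyn.injective h] at h1
        exact o.coeff_degree_ne_zero_iff.2 hp'0 h1
    obtain ⟨f, hf, hf0, hfd⟩ := ih _ hlt p' rfl
      (sub_mem (J.mul_mem_left _ hp) (J.mul_mem_left _ hgJ)) hmap0
    exact ⟨f, hf, hf0, hfd.trans hdeg⟩
  · refine ⟨p, hp, hp1, o.toSyn.injective (le_antisymm ?_ ?_)⟩
    · refine o.le_degree (mem_support_iff.2 ?_)
      rwa [coeff_map]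
    · exact o.degree_le_iff.2 fun m hm => o.le_degree (support_map_subset φ p hm)

/-- The substitution `x i ↦ y i * x i`. The variables `(0, i)`, `(1, i)`, `(2, i)` stand for `y i`,
the inverse of `y i`, and `x i`; the lexicographic order of the indices eliminates the first two
kinds. -/
noncomputable def rescaleHom (d : ℕ) (A : Type*) [CommRing A] :
    MvPolynomial (Fin d) A →ₐ[A] MvPolynomial (Fin 3 ×ₗ Fin d) A :=
  aeval fun i => X (toLex (0, i)) * X (toLex (2, i))

/-- The ideal generated by the rescaled elements of `J` and the relations saying that the scaling
parameters are units. -/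
noncomputable def rescaledIdeal {d : ℕ} {A : Type*} [CommRing A]
    (J : Ideal (MvPolynomial (Fin d) A)) : Ideal (MvPolynomial (Fin 3 ×ₗ Fin d) A) :=
  J.map (rescaleHom d A) ⊔
    Ideal.span (Set.range fun i => 1 - X (toLex (0, i)) * X (toLex (1, i)))

theorem rename_monomial_mem_map_rescaledIdeal {d : ℕ} {A B : Type*} [CommRing A] [CommRing B]
    (φ : A →+* B) {J : Ideal (MvPolynomial (Fin d) A)} {v : Fin d →₀ ℕ}
    (hv : monomial v 1 ∈ J.map (map φ)) :
    rename (fun i => toLex ((2 : Fin 3), i)) (monomial v (1 : B)) ∈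
      (rescaledIdeal J).map (map φ) := by
  set L := (rescaledIdeal J).map (map φ) with hL
  have hcomp : (map φ).comp (rescaleHom d A).toRingHom =
      (rescaleHom d B).toRingHom.comp (map φ) := by
    refine MvPolynomial.ringHom_ext (fun a => ?_) fun i => ?_ <;> simp [rescaleHom]
  have h1 : rescaleHom d B (monomial v 1) ∈ L := by
    have h2 := Ideal.mem_map_of_mem (rescaleHom d B).toRingHom hv
    rw [Ideal.map_map, ← hcomp, ← Ideal.map_map] at h2
    exact Ideal.map_mono le_sup_left h2
  have h2 : ∀ i : Fin d, (1 - X (toLex (0, i)) * X (toLex (1, i)) :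
      MvPolynomial (Fin 3 ×ₗ Fin d) B) ∈ L := by
    intro i
    have : (1 - X (toLex (0, i)) * X (toLex (1, i)) : MvPolynomial (Fin 3 ×ₗ Fin d) B) =
        map φ (1 - X (toLex (0, i)) * X (toLex (1, i))) := by simp
    rw [this]
    exact Ideal.mem_map_of_mem _ (Ideal.mem_sup_right (Ideal.subset_span ⟨i, rfl⟩))
  rw [← Ideal.Quotient.eq_zero_iff_mem] at h1 ⊢
  have h3 : ∀ i : Fin d, Ideal.Quotient.mk L (X (toLex (0, i))) *
      Ideal.Quotient.mk L (X (toLex (1, i))) = 1 := fun i => by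
    rw [← map_mul, ← map_one (Ideal.Quotient.mk L), eq_comm, Ideal.Quotient.eq]
    exact h2 i
  have h4 : rescaleHom d B (monomial v 1) = (∏ i, X (toLex (0, i)) ^ v i) *
      rename (fun i => toLex ((2 : Fin 3), i)) (monomial v (1 : B)) := by
    rw [monomial_eq, C_1, one_mul, Finsupp.prod_fintype _ _ (by simp), map_prod, map_prod,
      ← Finset.prod_mul_distrib]
    refine Finset.prod_congr rfl fun i _ => ?_
    rw [map_pow, map_pow, rename_X, ← mul_pow, rescaleHom, aeval_X]
  have h5 : (∏ i, Ideal.Quotient.mk L (X (toLex (1, i))) ^ v i) *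
      ∏ i, Ideal.Quotient.mk L (X (toLex (0, i))) ^ v i = 1 := by
    rw [← Finset.prod_mul_distrib]
    refine Finset.prod_eq_one fun i _ => ?_
    rw [← mul_pow, mul_comm, h3, one_pow]
  rw [h4, map_mul, map_prod] at h1
  simp only [map_pow] at h1
  rw [← one_mul (Ideal.Quotient.mk L _), ← h5, mul_assoc, h1, mul_zero]

/-- The elements of the rescaled ideal that are free of the scaling parameters have all their terms
in the original ideal. -/
theorem monomial_coeff_mem_of_rename_mem_rescaledIdeal {k A : Type*} [Field k] [Infinite k]
    [CommRing A] [Algebra k A] {d : ℕ} {J : Ideal (MvPolynomial (Fin d) A)}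
    {p : MvPolynomial (Fin d) A}
    (hp : rename (fun i => toLex ((2 : Fin 3), i)) p ∈ rescaledIdeal J) (e : Fin d →₀ ℕ) :
    monomial e (coeff e p) ∈ J := by
  refine monomial_coeff_mem_of_forall_rescale (k := k) (J.restrictScalars k) p (fun a ha => ?_) e
  let val (s : Fin 3 ×ₗ Fin d) : MvPolynomial (Fin d) A :=
    ![C (algebraMap k A (a (ofLex s).2)⁻¹), C (algebraMap k A (a (ofLex s).2)),
      C (algebraMap k A (a (ofLex s).2)) * X (ofLex s).2] (ofLex s).1
  let θ : MvPolynomial (Fin 3 ×ₗ Fin d) A →ₐ[A] MvPolynomial (Fin d) A := aeval val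
  have hinv : ∀ i, (C (algebraMap k A (a i)⁻¹) * C (algebraMap k A (a i)) :
      MvPolynomial (Fin d) A) = 1 := fun i => by
    rw [← C_mul, ← map_mul, inv_mul_cancel₀ (ha i), map_one, C_1]
  have hle : rescaledIdeal J ≤ J.comap θ := by
    refine sup_le (Ideal.map_le_iff_le_comap.2 fun x hx => ?_) (Ideal.span_le.2 ?_)
    · have : θ.comp (rescaleHom d A) = AlgHom.id A _ := by
        refine MvPolynomial.algHom_ext fun i => ?_
        rw [AlgHom.comp_apply, rescaleHom, aeval_X, map_mul, aeval_X, aeval_X]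
        change C (algebraMap k A (a i)⁻¹) * (C (algebraMap k A (a i)) * X i) = X i
        rw [← mul_assoc, hinv, one_mul]
      change (θ.comp (rescaleHom d A)) x ∈ J
      rwa [this]
    · rintro _ ⟨i, rfl⟩
      have : θ (1 - X (toLex (0, i)) * X (toLex (1, i))) = 0 := by
        rw [map_sub, map_one, map_mul, aeval_X, aeval_X]
        exact sub_eq_zero.2 (hinv i).symm
      change θ _ ∈ J
      rw [this]
      exact zero_mem J
  have h := hle hp
  rw [Ideal.mem_comap, aeval_rename] at h
  exact h

theorem vars_subset_of_lex_degree {d : ℕ} {A : Type*} [CommRing A]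
    {g : MvPolynomial (Fin 3 ×ₗ Fin d) A} {v : Fin d →₀ ℕ}
    (hg : MonomialOrder.lex.degree g = Finsupp.mapDomain (fun i => toLex ((2 : Fin 3), i)) v) :
    (g.vars : Set (Fin 3 ×ₗ Fin d)) ⊆ Set.range fun i => toLex ((2 : Fin 3), i) := by
  intro s hs
  obtain ⟨m, hm, hms⟩ := (mem_vars_iff_mem_support s).1 hs
  by_contra hsr
  have hle := MonomialOrder.lex.le_degree hm
  rw [hg, MonomialOrder.lex_le_iff] at hle
  set D := Finsupp.mapDomain (fun i : Fin d => toLex ((2 : Fin 3), i)) v with hD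
  have hD0 : ∀ t, t ∉ (Set.range fun i : Fin d => toLex ((2 : Fin 3), i)) → D t = 0 := fun t ht =>
    Finsupp.mapDomain_of_notMem_range _ _ ht
  have hms0 : m s ≠ 0 := Finsupp.mem_support_iff.1 hms
  rcases hle.lt_or_eq with hlt | heq
  · obtain ⟨t, hbelow, ht⟩ := Finsupp.Lex.lt_iff.1 hlt
    by_cases htr : t ∈ Set.range fun i : Fin d => toLex ((2 : Fin 3), i)
    · obtain ⟨i, rfl⟩ := htr
      have hst : s < toLex ((2 : Fin 3), i) := by
        refine Prod.Lex.lt_iff.2 (Or.inl (lt_of_le_of_ne (Fin.le_last _) fun h2 => hsr ?_))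
        exact ⟨(ofLex s).2, toLex.injective.eq_iff.2 (Prod.ext h2.symm rfl)⟩
      exact hms0 ((hbelow s hst).trans (hD0 s hsr))
    · exact absurd (hD0 t htr) (Nat.ne_of_gt (Nat.zero_lt_of_lt ht))
  · rw [toLex.injective heq] at hms0
    exact hms0 (hD0 s hsr)

/-- The specializations of an ideal at general points contain no monomials other than those with
a nonzero multiple in the ideal. The ideal is transformed by rescaling `x i` with new units `y i`;
the elements free of the `y i` then have all their terms in the original ideal, and eliminating the
`y i` commutes with general specialization. -/
theorem exists_forall_monomial_mem_of_map {k A : Type*} [Field k] [Infinite k] [CommRing A]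
    [IsDomain A] [Algebra k A] {d : ℕ} (J : Ideal (MvPolynomial (Fin d) A)) :
    ∃ q : A, q ≠ 0 ∧ ∀ {B : Type*} [CommRing B] [IsDomain B] (φ : A →+* B),
      Function.Surjective φ → φ q ≠ 0 →
      ∀ v, monomial v 1 ∈ J.map (map φ) → ∃ c ≠ 0, monomial v c ∈ J := by
  classical
  obtain ⟨q, hq, h⟩ := exists_forall_degree_map_eq MonomialOrder.lex (rescaledIdeal J)
  refine ⟨q, hq, fun φ hφ hφq v hv => ?_⟩
  obtain ⟨p, hp, hpv⟩ := (Ideal.mem_map_iff_of_surjective _ (map_surjective φ hφ)).1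
    (rename_monomial_mem_map_rescaledIdeal φ hv)
  have hinj : Function.Injective fun i : Fin d => toLex ((2 : Fin 3), i) :=
    fun i j h => congrArg Prod.snd (toLex.injective h)
  rw [rename_monomial] at hpv
  obtain ⟨g, hg, hg0, hgd⟩ := h φ hφq p hp (by rw [hpv]; simp)
  rw [hpv, MonomialOrder.degree_monomial, if_neg one_ne_zero] at hgd
  obtain ⟨g', rfl⟩ := exists_rename_eq_of_vars_subset_range g _ hinj
    (vars_subset_of_lex_degree hgd)
  refine ⟨coeff v g', ?_, monomial_coeff_mem_of_rename_mem_rescaledIdeal (k := k) hg v⟩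
  rw [← coeff_rename_mapDomain _ hinj, ← hgd]
  exact MonomialOrder.lex.coeff_degree_ne_zero_iff.2 hg0

end Specialization

/-! ### Specializations of the generic ideal -/

section GenericIdeal

variable {σ k : Type*} [Field k] {s u : ℕ} {f : Fin u → MvPolynomial σ k}

theorem evalParam_map_C {τ : Type*} (lam : τ → k) (p : MvPolynomial σ k) :
    evalParam lam (map (C : k →+* MvPolynomial τ k) p) = p := by
  have h : (eval lam).comp (C : k →+* MvPolynomial τ k) = RingHom.id k :=
    RingHom.ext fun c => eval_C c
  rw [evalParam, map_map, h, map_id]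

theorem map_genericIdeal (f : Fin u → MvPolynomial σ k) (lam : Fin s × Fin u → k) :
    (genericIdeal s f).map (evalParam lam) =
      Ideal.span (Set.range fun i => ∑ j, lam (i, j) • f j) := by
  rw [genericIdeal, Ideal.map_span, ← Set.range_comp]
  congr 2
  funext i
  simp only [Function.comp_apply, map_sum, map_mul, evalParam_map_C, smul_eq_C_mul]
  refine Finset.sum_congr rfl fun j _ => ?_
  rw [evalParam, map_C, eval_X]

/-- If the combinations with coefficients `lam` generate a reduction, then the generic combinations
generate a reduction after a localization in which `lam` is still a point: by Nakayama's lemma over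
the local ring of the parameter space at `lam`. -/
theorem exists_eval_eq_one_forall_mem {lam : Fin s × Fin u → k} {n : ℕ}
    (h : Submodule.span k (Set.range f) ^ (n + 1) ≤
      Submodule.span k (Set.range fun i => ∑ j, lam (i, j) • f j) *
        Submodule.span k (Set.range f) ^ n) :
    ∃ r : MvPolynomial (Fin s × Fin u) k, eval lam r = 1 ∧
      ∀ p ∈ Submodule.span k (Set.range f) ^ (n + 1), C r * map C p ∈
        genericIdeal s f * (Ideal.span (Set.range f)).map (map C) ^ n := by
  set A := MvPolynomial (Fin s × Fin u) k
  set V := Submodule.span k (Set.range f) with hV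
  let ι : MvPolynomial σ k →+* MvPolynomial σ A := map C
  set M : Submodule A (MvPolynomial σ A) := Submodule.span A (ι '' (V ^ (n + 1) : Submodule k _))
    with hM
  set N : Submodule A (MvPolynomial σ A) := (genericIdeal s f *
    (Ideal.span (Set.range f)).map ι ^ n).restrictScalars A with hN
  have hιsmul : ∀ (c : k) p, ι (c • p) = (C c : A) • ι p := fun c p => by
    rw [smul_eq_C_mul, smul_eq_C_mul, map_mul, map_C]
  have hfg : M.FG := by
    obtain ⟨t, ht⟩ : (V ^ (n + 1)).FG := (Submodule.fg_span (Set.finite_range f)).pow (n + 1)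
    classical
    refine ⟨t.image ι, le_antisymm (Submodule.span_mono ?_) (Submodule.span_le.2 ?_)⟩
    · rw [Finset.coe_image]
      rw [← ht]
      exact Set.image_mono Submodule.subset_span
    · rintro _ ⟨p, hp, rfl⟩
      rw [SetLike.mem_coe, ← ht] at hp
      induction hp using Submodule.span_induction with
      | mem x hx => exact Submodule.subset_span (Finset.mem_coe.2 (Finset.mem_image_of_mem _ hx))
      | zero => rw [map_zero]; exact zero_mem _
      | add x y _ _ hx hy => rw [map_add]; exact add_mem hx hy
      | smul c x _ hx => rw [hιsmul]; exact Submodule.smul_mem _ _ hx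
  have hpow : ∀ m, ∀ w ∈ V ^ m, ι w ∈ (Ideal.span (Set.range f)).map ι ^ m := fun m w hw => by
    rw [← Ideal.map_pow]
    refine Ideal.mem_map_of_mem _ ?_
    have h1 : Ideal.span (V : Set (MvPolynomial σ k)) = Ideal.span (Set.range f) :=
      Submodule.span_span_of_tower k _ _
    rw [← h1, ← span_coe_pow]
    exact Ideal.subset_span hw
  have hle : M ≤ N ⊔ RingHom.ker (eval lam) • M := by
    refine Submodule.span_le.2 ?_
    rintro _ ⟨p, hp, rfl⟩
    refine Submodule.mul_induction_on (h hp) (fun g hg w hw => ?_) fun x y hx hy => ?_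
    · induction hg using Submodule.span_induction with
      | zero => rw [zero_mul, map_zero]; exact zero_mem _
      | add x y _ _ hx hy => rw [add_mul, map_add]; exact add_mem hx hy
      | smul c x _ hx => rw [smul_mul_assoc, hιsmul]; exact Submodule.smul_mem _ _ hx
      | mem x hx =>
        obtain ⟨i, rfl⟩ := hx
        -- `b` agrees with its value at `lam` up to the maximal ideal of `lam`
        set b : MvPolynomial σ A := ∑ j, C (X (i, j)) * map C (f j) with hb
        have hbw : b * ι w ∈ N :=
          Ideal.mul_mem_mul (Ideal.subset_span ⟨i, rfl⟩) (hpow n w hw)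
        have heq : ι ((∑ j, lam (i, j) • f j) * w) = b * ι w +
            ∑ j, (C (lam (i, j)) - X (i, j) : A) • ι (f j * w) := by
          simp only [map_mul, map_sum, hb, Finset.sum_mul, smul_eq_C_mul, map_sub, sub_mul]
          rw [← Finset.sum_add_distrib]
          refine Finset.sum_congr rfl fun j _ => ?_
          change _ = C (X (i, j)) * ι (f j) * ι w + _
          rw [show ι (C (lam (i, j))) = C (C (lam (i, j))) from map_C _ _]
          ring
        rw [heq]
        refine add_mem (Submodule.mem_sup_left hbw)
          (Submodule.mem_sup_right (sum_mem fun j _ => ?_))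
        refine Submodule.smul_mem_smul ?_ (Submodule.subset_span ⟨_, ?_, rfl⟩)
        · rw [RingHom.mem_ker, map_sub, eval_C, eval_X, sub_self]
        · rw [pow_succ']
          exact Submodule.mul_mem_mul (Submodule.subset_span ⟨j, rfl⟩) hw
    · rw [map_add]; exact add_mem hx hy
  obtain ⟨r, hr, hrM⟩ := Submodule.exists_sub_one_mem_and_smul_le_of_fg_of_le_sup hfg le_rfl hle
  refine ⟨r, ?_, fun p hp => ?_⟩
  · rwa [RingHom.mem_ker, map_sub, map_one, sub_eq_zero] at hr
  · rw [← smul_eq_C_mul]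
    exact hrM (Submodule.smul_mem_pointwise_smul _ r M (Submodule.subset_span ⟨p, hp, rfl⟩))

/-- Being a reduction is an open condition on the coefficients. -/
theorem isReductionOf_map_genericIdeal {n : ℕ} {r : MvPolynomial (Fin s × Fin u) k}
    (hr : ∀ p ∈ Submodule.span k (Set.range f) ^ (n + 1), C r * map C p ∈
        genericIdeal s f * (Ideal.span (Set.range f)).map (map C) ^ n)
    {lam : Fin s × Fin u → k} (hlam : eval lam r ≠ 0) :
    IsReductionOf ((genericIdeal s f).map (evalParam lam)) (Ideal.span (Set.range f)) := by
  set I := Ideal.span (Set.range f) with hI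
  set J := (genericIdeal s f).map (evalParam lam) with hJ
  have hV : Ideal.span (Submodule.span k (Set.range f) : Set (MvPolynomial σ k)) = I :=
    Submodule.span_span_of_tower k _ _
  have hle : J ≤ I := by
    rw [hJ, map_genericIdeal]
    refine Ideal.span_le.2 ?_
    rintro _ ⟨i, rfl⟩
    refine sum_mem fun j _ => ?_
    rw [smul_eq_C_mul]
    exact Ideal.mul_mem_left _ _ (Ideal.subset_span ⟨j, rfl⟩)
  refine ⟨hle, n, le_antisymm ?_ ?_⟩
  · rw [← hV, ← span_coe_pow, hV]
    refine Ideal.span_le.2 fun p hp => ?_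
    have h1 := Ideal.mem_map_of_mem (evalParam lam) (hr p hp)
    have hid : (evalParam lam).comp (map (C : k →+* MvPolynomial (Fin s × Fin u) k)) =
        RingHom.id (MvPolynomial σ k) := RingHom.ext (evalParam_map_C lam)
    rw [map_mul, evalParam_map_C, Ideal.map_mul, Ideal.map_pow, Ideal.map_map, hid,
      Ideal.map_id, evalParam, map_C] at h1
    have h2 := Ideal.mul_mem_left _ (C (eval lam r)⁻¹) h1
    rwa [← mul_assoc, ← C_mul, inv_mul_cancel₀ hlam, C_1, one_mul] at h2
  · rw [pow_succ']
    exact Ideal.mul_mono_left hle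

end GenericIdeal

/-! ### Monomial ideals and the graded core -/

section MonomialIdeals

/-- The coefficient at `w` of an element of `∑ C_i x ^ v_i` lies in the sum of those `C_i` for which
`x ^ v_i` divides `x ^ w`. -/
theorem coeff_mem_of_mem_iSup {σ A ι : Type*} [CommRing A] {c : ι → Ideal A} {v : ι → σ →₀ ℕ}
    {p : MvPolynomial σ A}
    (hp : p ∈ ⨆ i, (c i).map (C : A →+* MvPolynomial σ A) * Ideal.span {monomial (v i) 1})
    (w : σ →₀ ℕ) : coeff w p ∈ ⨆ i, ⨆ _ : v i ≤ w, c i := by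
  induction hp using Submodule.iSup_induction' with
  | zero => rw [coeff_zero]; exact zero_mem _
  | add x y _ _ hx hy => rw [coeff_add]; exact add_mem hx hy
  | mem i x hx =>
    obtain ⟨z, hz, rfl⟩ := Ideal.mem_mul_span_singleton.1 hx
    rw [coeff_mul_monomial', mul_one]
    split_ifs with h
    · exact (le_iSup₂_of_le i h le_rfl : c i ≤ _) (mem_map_C_iff.1 hz _)
    · exact zero_mem _

attribute [local instance] MvPolynomial.gradedAlgebra

/-- Rescaling of the variables permutes the homogeneous reductions of a monomial ideal. -/
theorem isReductionOf_map_rescale {σ k ι : Type*} [Field k] {f : ι → MvPolynomial σ k}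
    (hf : ∀ j, ∃ e : σ →₀ ℕ, f j = monomial e 1) {a : σ → k} (ha : ∀ i, a i ≠ 0)
    {K : Ideal (MvPolynomial σ k)} (hK : K.IsHomogeneous (homogeneousSubmodule σ k))
    (hred : IsReductionOf K (Ideal.span (Set.range f))) :
    (K.map (aeval fun i => C (a i) * X i : MvPolynomial σ k →ₐ[k] MvPolynomial σ k)).IsHomogeneous
      (homogeneousSubmodule σ k) ∧
    IsReductionOf (K.map (aeval fun i => C (a i) * X i : MvPolynomial σ k →ₐ[k] MvPolynomial σ k))
      (Ideal.span (Set.range f)) := by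
  set θ : MvPolynomial σ k →ₐ[k] MvPolynomial σ k := aeval fun i => C (a i) * X i with hθ
  set I := Ideal.span (Set.range f) with hI
  have hθf : ∀ j, ∃ c : k, c ≠ 0 ∧ θ (f j) = C c * f j := by
    intro j
    obtain ⟨e, he⟩ := hf j
    refine ⟨e.prod fun i n => a i ^ n, Finset.prod_ne_zero_iff.2 fun i _ => pow_ne_zero _ (ha i),
      ?_⟩
    rw [he, hθ, aeval_monomial, monomial_eq]
    simp only [mul_pow, Finsupp.prod, Finset.prod_mul_distrib, map_prod, map_pow, map_one, one_mul]
  have hIθ : I.map θ = I := by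
    apply le_antisymm
    · refine Ideal.map_le_iff_le_comap.2 (Ideal.span_le.2 ?_)
      rintro _ ⟨j, rfl⟩
      obtain ⟨c, -, hc⟩ := hθf j
      change θ (f j) ∈ I
      rw [hc]
      exact Ideal.mul_mem_left _ _ (Ideal.subset_span ⟨j, rfl⟩)
    · refine Ideal.span_le.2 ?_
      rintro _ ⟨j, rfl⟩
      obtain ⟨c, hc0, hc⟩ := hθf j
      have h1 : f j = C c⁻¹ * θ (f j) := by
        rw [hc, ← mul_assoc, ← C_mul, inv_mul_cancel₀ hc0, C_1, one_mul]
      rw [SetLike.mem_coe, h1]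
      exact Ideal.mul_mem_left _ _ (Ideal.mem_map_of_mem _ (Ideal.subset_span ⟨j, rfl⟩))
  constructor
  · obtain ⟨S, rfl⟩ := (Ideal.IsHomogeneous.iff_exists _ _).1 hK
    rw [Ideal.map_span]
    refine Ideal.homogeneous_span _ _ ?_
    rintro _ ⟨_, ⟨x, -, rfl⟩, rfl⟩
    obtain ⟨n, hn⟩ := x.2
    refine ⟨n, ?_⟩
    have := IsHomogeneous.aeval (g := fun i => C (a i) * X i) (n := 1) hn
      fun i => isHomogeneous_C_mul_X (a i) i
    rwa [one_mul] at this
  · obtain ⟨hle, n, hn⟩ := hred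
    refine ⟨hIθ ▸ Ideal.map_mono hle, n, ?_⟩
    have := congrArg (Ideal.map θ) hn
    rwa [Ideal.map_mul, Ideal.map_pow, Ideal.map_pow, hIθ] at this

theorem mem_gradedCore_iff {σ k : Type*} [CommRing k] {I : Ideal (MvPolynomial σ k)}
    {p : MvPolynomial σ k} : p ∈ gradedCore I ↔
      ∀ K : Ideal (MvPolynomial σ k), K.IsHomogeneous (homogeneousSubmodule σ k) →
        IsReductionOf K I → p ∈ K := by
  rw [gradedCore, Submodule.mem_sInf]
  exact ⟨fun h K h1 h2 => h K ⟨h1, h2⟩, fun h K hK => h K hK.1 hK.2⟩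

/-- The graded core of a monomial ideal is a monomial ideal. -/
theorem monomial_coeff_mem_gradedCore {σ k ι : Type*} [Field k] [Infinite k]
    {f : ι → MvPolynomial σ k} (hf : ∀ j, ∃ e : σ →₀ ℕ, f j = monomial e 1)
    {p : MvPolynomial σ k} (hp : p ∈ gradedCore (Ideal.span (Set.range f))) (e : σ →₀ ℕ) :
    monomial e (coeff e p) ∈ gradedCore (Ideal.span (Set.range f)) := by
  refine monomial_coeff_mem_of_forall_rescale (k := k)
    ((gradedCore (Ideal.span (Set.range f))).restrictScalars k) p (fun a ha => ?_) e
  rw [Submodule.restrictScalars_mem, mem_gradedCore_iff]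
  intro K hK hred
  obtain ⟨h1, h2⟩ := isReductionOf_map_rescale hf (fun i => inv_ne_zero (ha i)) hK hred
  have h3 := Ideal.mem_map_of_mem
    (aeval fun i => C (a i) * X i : MvPolynomial σ k →ₐ[k] MvPolynomial σ k)
    (mem_gradedCore_iff.1 hp _ h1 h2)
  rw [Ideal.map_mapₐ] at h3
  have hid : (aeval fun i => C (a i) * X i : MvPolynomial σ k →ₐ[k] MvPolynomial σ k).comp
      (aeval fun i => C (a i)⁻¹ * X i) = AlgHom.id k _ := by
    refine MvPolynomial.algHom_ext fun i => ?_
    rw [AlgHom.comp_apply, aeval_X, map_mul, aeval_X, ← algebraMap_eq, AlgHom.commutes,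
      algebraMap_eq, ← mul_assoc, ← C_mul, inv_mul_cancel₀ (ha i), C_1, one_mul]
    rfl
  rw [hid] at h3
  exact (Ideal.map_id K) ▸ h3

theorem mem_mono_of_forall_monomial_coeff_mem {σ A : Type*} [CommRing A]
    {L : Ideal (MvPolynomial σ A)} {p : MvPolynomial σ A}
    (h : ∀ e, monomial e (coeff e p) ∈ L) : p ∈ mono L := by
  rw [p.as_sum]
  exact sum_mem fun e _ => Ideal.subset_span ⟨h e, e, _, rfl⟩

end MonomialIdeals

/-! ### The graded core of a monomial ideal generated in one degree -/

section

attribute [local instance] MvPolynomial.gradedAlgebra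

theorem theorem5p9 {k : Type*} [Field k] [Infinite k] (d u r δ ℓ : ℕ)
    (I : Ideal (MvPolynomial (Fin d) k)) (hI : I ≠ ⊥)
    (f : Fin u → MvPolynomial (Fin d) k)
    (hf : ∀ j, ∃ e : Fin d →₀ ℕ, e.degree = δ ∧ f j = monomial e 1)
    (hgen : Ideal.span (Set.range f) = I)
    (hℓ : analyticSpread I = (ℓ : WithBot ℕ∞))
    (v : Fin r → Fin d →₀ ℕ) (hv : Function.Injective v)
    (coeffIdeal : Fin r → Ideal (MvPolynomial (Fin ℓ × Fin u) k))
    (hmono : mono (genericIdeal ℓ f) =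
      ⨆ i, (coeffIdeal i).map (C : MvPolynomial (Fin ℓ × Fin u) k →+* _) *
        Ideal.span {monomial (v i) 1})
    (hrad : ∀ i, (coeffIdeal i).radical = (⨆ j, coeffIdeal j).radical) :
    ForGeneral fun lam : Fin ℓ × Fin u → k =>
      gradedCore I = mono ((genericIdeal ℓ f).map (evalParam lam)) := by
  classical
  subst hgen
  have hf' : ∀ j, ∃ e : Fin d →₀ ℕ, f j = monomial e 1 := fun j =>
    let ⟨e, _, he⟩ := hf j; ⟨e, he⟩
  have hfδ : ∀ j, (f j).IsHomogeneous δ := fun j => by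
    obtain ⟨e, he, hfe⟩ := hf j
    rw [hfe]; exact isHomogeneous_monomial 1 he
  set V := Submodule.span k (Set.range f) with hV
  have hVδ : V ≤ homogeneousSubmodule (Fin d) k δ :=
    Submodule.span_le.2 (Set.range_subset_iff.2 hfδ)
  have hVI : Ideal.span (V : Set (MvPolynomial (Fin d) k)) = Ideal.span (Set.range f) :=
    Submodule.span_span_of_tower k _ _
  -- every homogeneous reduction contains a specialization of the generic ideal at some point `mu`
  -- near which the generic ideal specializes to a reduction
  have key : ∀ K : Ideal (MvPolynomial (Fin d) k), K.IsHomogeneous (homogeneousSubmodule _ k) →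
      IsReductionOf K (Ideal.span (Set.range f)) → ∃ mu : Fin ℓ × Fin u → k,
      (genericIdeal ℓ f).map (evalParam mu) ≤ K ∧ ∃ (n : ℕ) (q : MvPolynomial (Fin ℓ × Fin u) k),
        eval mu q = 1 ∧ ∀ p ∈ V ^ (n + 1), C q * map C p ∈
          genericIdeal ℓ f * (Ideal.span (Set.range f)).map (map C) ^ n := by
    intro K hK hred
    obtain ⟨g, hg, n, hn⟩ := exists_reduction_of_analyticSpread hVδ
      (Submodule.fg_span (Set.finite_range f)) hVI hℓ hK hred
    have hgmu : ∀ i, ∃ c : Fin u → k, ∑ j, c j • f j = g i := fun i =>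
      (Submodule.mem_span_range_iff_exists_fun k).1 (hg i).2
    choose mu hmu using hgmu
    have hrange : (fun i => ∑ j, (fun ij : Fin ℓ × Fin u => mu ij.1 ij.2) (i, j) • f j) = g :=
      funext hmu
    refine ⟨fun ij => mu ij.1 ij.2, ?_, n, exists_eval_eq_one_forall_mem (hrange ▸ hn)⟩
    rw [map_genericIdeal, hrange]
    exact Ideal.span_le.2 (Set.range_subset_iff.2 fun i => (hg i).1)
  have hu : Nonempty (Fin u) := by
    by_contra h
    rw [not_nonempty_iff] at h
    exact hI (by rw [Set.range_eq_empty, Ideal.span_empty])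
  obtain ⟨j₀⟩ := hu
  obtain ⟨e₀, -, he₀⟩ := hf j₀
  -- a point at which the generic ideal specializes to a reduction is outside the zero locus of the
  -- content ideal, hence outside the zero locus of each coefficient ideal
  have hcontent : ∀ (mu : Fin ℓ × Fin u → k) (n : ℕ) (q : MvPolynomial (Fin ℓ × Fin u) k),
      eval mu q = 1 → (∀ p ∈ V ^ (n + 1), C q * map C p ∈
        genericIdeal ℓ f * (Ideal.span (Set.range f)).map (map C) ^ n) →
      ∀ i, ∃ c ∈ coeffIdeal i, eval mu c ≠ 0 := by
    intro mu n q hq h i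
    have h0 : f j₀ ^ (n + 1) ∈ V ^ (n + 1) :=
      Submodule.pow_mem_pow V (Submodule.subset_span ⟨j₀, rfl⟩) _
    have h1 := Ideal.mul_le_left (h _ h0)
    rw [he₀, monomial_pow, one_pow, map_monomial, C_1, C_mul_monomial, mul_one] at h1
    have h2 : monomial ((n + 1) • e₀) q ∈ mono (genericIdeal ℓ f) :=
      Ideal.subset_span ⟨h1, _, _, rfl⟩
    rw [hmono] at h2
    have h3 := coeff_mem_of_mem_iSup h2 ((n + 1) • e₀)
    rw [coeff_monomial, if_pos rfl] at h3
    have h4 : q ∈ (⨆ j, coeffIdeal j).radical :=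
      Ideal.le_radical ((iSup_mono fun j => iSup_le fun _ => le_rfl : _ ≤ ⨆ j, coeffIdeal j) h3)
    rw [← hrad i] at h4
    by_contra! hc
    have h5 : (coeffIdeal i).radical ≤ RingHom.ker (eval mu) :=
      (RingHom.ker_isPrime (eval mu)).radical_le_iff.2 hc
    exact one_ne_zero (hq.symm.trans (h5 h4))
  obtain ⟨q₂, hq₂, hmem⟩ := exists_forall_monomial_mem_of_map (k := k) (genericIdeal ℓ f)
  have hself : (Ideal.span (Set.range f)).IsHomogeneous (homogeneousSubmodule (Fin d) k) := by
    refine Ideal.homogeneous_span _ _ ?_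
    rintro _ ⟨j, rfl⟩
    exact ⟨δ, hfδ j⟩
  obtain ⟨mu₀, -, n₀, q₁, hq₁, hred₁⟩ := key _ hself
    ⟨le_rfl, 0, by rw [zero_add, pow_one, pow_zero, mul_one]⟩
  refine ⟨q₁ * q₂, mul_ne_zero ?_ hq₂, fun lam hlam => ?_⟩
  · rintro rfl
    rw [map_zero] at hq₁
    exact zero_ne_one hq₁
  rw [map_mul] at hlam
  apply le_antisymm
  · intro p hp
    refine mem_mono_of_forall_monomial_coeff_mem fun e => ?_
    refine mem_gradedCore_iff.1 (monomial_coeff_mem_gradedCore hf' hp e) _ ?_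
      (isReductionOf_map_genericIdeal hred₁ (left_ne_zero_of_mul hlam))
    rw [map_genericIdeal]
    refine Ideal.homogeneous_span _ _ ?_
    rintro _ ⟨i, rfl⟩
    exact ⟨δ, Submodule.sum_mem _ fun j _ => Submodule.smul_mem _ _ (hfδ j)⟩
  · refine Ideal.span_le.2 ?_
    rintro _ ⟨hp, m, a, rfl⟩
    rw [SetLike.mem_coe, mem_gradedCore_iff]
    intro K hK hred
    rcases eq_or_ne a 0 with rfl | ha
    · rw [monomial_zero]; exact zero_mem _
    have hm1 : monomial m 1 ∈ (genericIdeal ℓ f).map (evalParam lam) := by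
      have := Ideal.mul_mem_left _ (C a⁻¹) hp
      rwa [C_mul_monomial, inv_mul_cancel₀ ha] at this
    have hsurj : Function.Surjective (eval lam) := fun c => ⟨C c, eval_C c⟩
    obtain ⟨c, hc0, hc⟩ := hmem (eval lam) hsurj (right_ne_zero_of_mul hlam) m hm1
    have h1 : monomial m c ∈ mono (genericIdeal ℓ f) := Ideal.subset_span ⟨hc, _, _, rfl⟩
    rw [hmono] at h1
    have h2 := coeff_mem_of_mem_iSup h1 m
    rw [coeff_monomial, if_pos rfl] at h2
    obtain ⟨i, hi⟩ : ∃ i, v i ≤ m := by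
      by_contra! hno
      simp only [hno, iSup_false, iSup_bot, Ideal.mem_bot] at h2
      exact hc0 h2
    obtain ⟨mu, hmuK, n, q, hq, hmu⟩ := key K hK hred
    obtain ⟨c', hc', hc'0⟩ := hcontent mu n q hq hmu i
    have h3 : C c' * monomial (v i) 1 ∈ mono (genericIdeal ℓ f) := by
      rw [hmono]
      exact Submodule.mem_iSup_of_mem i (Ideal.mul_mem_mul (Ideal.mem_map_of_mem _ hc')
        (Ideal.subset_span rfl))
    have h4 : C c' * monomial (v i) 1 ∈ genericIdeal ℓ f :=
      (Ideal.span_le.2 (fun x hx => hx.1) : mono (genericIdeal ℓ f) ≤ genericIdeal ℓ f) h3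
    have h5 := hmuK (Ideal.mem_map_of_mem (evalParam mu) h4)
    rw [C_mul_monomial, mul_one, evalParam, map_monomial] at h5
    have h6 := K.mul_mem_left (monomial (m - v i) (a * (eval mu c')⁻¹)) h5
    rwa [monomial_mul, tsub_add_cancel_of_le hi, mul_assoc, inv_mul_cancel₀ hc'0, mul_one] at h6

end
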